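/- There are universal constants $C>0$ and $c>0$ such that the following holds. Let $n,d\ge 1$ be integers, $v>0$, and let $\lambda=(\lambda_1,\dots,\lambda_d)$ have positive entries. Let $(z_{i,j})_{1\le i\le n,\,1\le j\le d}$ be independent random variables with $\mathbb E(z_{i,j})=0$, $\mathbb E(z_{i,j}^2)=1$ and $\mathbb E(e^{tz_{i,j}})\le e^{vt^2/2}$ for all $t\in\mathbb R$, and let $x_i=(\lambda_j^{1/2}z_{i,j})_{j=1}^d\in\mathbb R^d$ for $i=1,\dots,n$. Let $y_1,\dots,y_n$ be $\{-1,+1\}$-valued random variables such that, for each $i$, $y_i$ is conditionally independent of $(x_j,y_j)_{j\ne i}$ given $x_i$. Call $(x_i,y_i)$ a support vector if the dual of the hard-margin SVM problem, that is, the problem of maximizing $\sum_{k}\alpha_k-\frac12\sum_{k,l}\alpha_k\alpha_l y_ky_l\,x_k^{\mathsf T}x_l$ over $\alpha\in\mathbb R^n$ with $\alpha_k\ge 0$ for all $k$, has an optimal solution, and every optimal solution $\alpha^\star$ has $\alpha_i^\star>0$ (the optimal solution is unique when the Gram matrix $(x_k^{\mathsf T}x_l)_{k,l}$ is non-singular).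 Then the probability that every training example $(x_1,y_1),\dots,(x_n,y_n)$ is a support vector is at least $$1-\exp\Bigl(-c\cdot\min\Bigl\{\frac{d_2}{v^2},\frac{d_\infty}{v}\Bigr\}+Cn\Bigr)-\exp\Bigl(-c\cdot\frac{d_\infty}{vn}+C\log n\Bigr),$$ where $d_2=\|\lambda\|_1^2/\|\lambda\|_2^2$ and $d_\infty=\|\lambda\|_1/\|\lambda\|_\infty$. -/

import Mathlib

open MeasureTheory ProbabilityTheory
open scoped BigOperators NNReal Matrix

noncomputable section

/-- Objective of the dual of the hard-margin SVM problem
`min ½‖w‖²` subject to `yᵢ ⟪xᵢ, w⟫ ≥ 1`, namely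
`∑ᵢ αᵢ - ½ αᵀ diag(y)ᵀ K diag(y) α`, where `K` is the Gram matrix of `x₁, …, xₙ`. -/
def svmDualObjective {n d : ℕ} (x : Fin n → EuclideanSpace ℝ (Fin d)) (y : Fin n → ℝ)
    (α : Fin n → ℝ) : ℝ :=
  ∑ i, α i -
    1 / 2 * (α ⬝ᵥ (((Matrix.diagonal y)ᵀ * Matrix.gram ℝ x * Matrix.diagonal y) *ᵥ α))

/-- `α` is an optimal solution of the SVM dual: a maximizer of the dual objective over `α ≥ 0`. -/
def IsSVMDualOptimal {n d : ℕ} (x : Fin n → EuclideanSpace ℝ (Fin d)) (y : Fin n → ℝ)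
    (α : Fin n → ℝ) : Prop :=
  (∀ i, 0 ≤ α i) ∧
    ∀ α' : Fin n → ℝ, (∀ i, 0 ≤ α' i) → svmDualObjective x y α' ≤ svmDualObjective x y α

/-- The `i`-th training example is a support vector: the SVM dual is solvable and its optimal
solution has a positive `i`-th coordinate. The dual optimum is unique when the Gram matrix is
non-singular; in case of several optimal solutions all of them are required to be positive
at `i`. -/
def IsSupportVector {n d : ℕ} (x : Fin n → EuclideanSpace ℝ (Fin d)) (y : Fin n → ℝ)
    (i : Fin n) : Prop :=
  (∃ α, IsSVMDualOptimal x y α) ∧ ∀ α, IsSVMDualOptimal x y α → 0 < α i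

/-- The effective dimension `d₂ = ‖λ‖₁² / ‖λ‖₂²`. -/
def effDimTwo {d : ℕ} (lam : Fin d → ℝ) : ℝ :=
  (∑ j, |lam j|) ^ 2 / ∑ j, lam j ^ 2

/-- The effective dimension `d_∞ = ‖λ‖₁ / ‖λ‖_∞` (the norm on `Fin d → ℝ` is the sup norm). -/
def effDimInf {d : ℕ} (lam : Fin d → ℝ) : ℝ :=
  (∑ j, |lam j|) / ‖lam‖

/-- The feature vectors `xᵢ = diag(λ)^{1/2} zᵢ`. -/
def featureVec {Ω : Type*} {n d : ℕ} (lam : Fin d → ℝ) (z : Fin n → Fin d → Ω → ℝ)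
    (i : Fin n) (ω : Ω) : EuclideanSpace ℝ (Fin d) :=
  WithLp.toLp 2 (fun j => Real.sqrt (lam j) * z i j ω)

/-- The entries `z i j` are independent random variables, each with mean zero, unit variance and
sub-Gaussian with parameter `v`, that is `E[exp (t z)] ≤ exp (v t² / 2)` for all real `t`
(with `exp (t z)` integrable). -/
structure IndependentFeatures {Ω : Type*} [MeasurableSpace Ω] {n d : ℕ}
    (z : Fin n → Fin d → Ω → ℝ) (v : ℝ≥0) (μ : Measure Ω) : Prop where
  measurable : ∀ i j, Measurable (z i j)
  indep : iIndepFun (fun p : Fin n × Fin d => z p.1 p.2) μ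
  mean_zero : ∀ i j, ∫ ω, z i j ω ∂μ = 0
  unit_variance : ∀ i j, ∫ ω, z i j ω ^ 2 ∂μ = 1
  subGaussian : ∀ i j, HasSubgaussianMGF (z i j) v μ

/-- Conditional independence of the random elements `f` and `g` given the sub-σ-algebra `m'`, on
an arbitrary probability space: `P(f ∈ s, g ∈ t | m') = P(f ∈ s | m') P(g ∈ t | m')` a.s. for all
measurable `s`, `t`. (On a standard Borel space this is `ProbabilityTheory.CondIndepFun`.) -/
def CondIndepGiven {Ω β γ : Type*} [MeasurableSpace β] [MeasurableSpace γ]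
    (m' : MeasurableSpace Ω) [MeasurableSpace Ω] (f : Ω → β) (g : Ω → γ) (μ : Measure Ω) : Prop :=
  ∀ (s : Set β) (t : Set γ), MeasurableSet s → MeasurableSet t →
    μ⟦f ⁻¹' s ∩ g ⁻¹' t | m'⟧ =ᵐ[μ] μ⟦f ⁻¹' s | m'⟧ * μ⟦g ⁻¹' t | m'⟧

/-- The label model: the labels are `±1`-valued random variables, and for each `i`, conditionally
on `xᵢ`, the label `yᵢ` is independent of all the other examples `(xⱼ, yⱼ)`, `j ≠ i`. -/
structure LabelModel {Ω : Type*} [MeasurableSpace Ω] {n d : ℕ}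
    (x : Fin n → Ω → EuclideanSpace ℝ (Fin d)) (y : Fin n → Ω → ℝ) (μ : Measure Ω) : Prop where
  measurable : ∀ i, Measurable (y i)
  sign : ∀ i ω, y i ω = 1 ∨ y i ω = -1
  condIndep : ∀ i, CondIndepGiven (MeasurableSpace.comap (x i) inferInstance) (y i)
    (fun ω (j : {j : Fin n // j ≠ i}) => (x j ω, y j ω)) μ

end

/-!
The dual optimum is the vector of signed coefficients `yᵢ βᵢ` of the minimum norm interpolant
`u = ∑ βₖ xₖ` of the labels, as soon as these are all positive. If `wᵢ` denotes the minimum norm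
interpolant of the other examples, then `u - wᵢ` is orthogonal to every `xₖ` with `k ≠ i`, so
`‖u - wᵢ‖² = βᵢ (yᵢ - ⟪xᵢ, wᵢ⟫)`; hence `|⟪xᵢ, wᵢ⟫| < 1` for all `i` makes every example a support
vector (`isSupportVector_of_forall_abs_inner_lt_one`).

Two events have to be controlled. First, with `L = ‖λ‖₁`, the Gram matrix is bounded below by `L / 2`
outside an event of probability `exp (-c min (d₂ / v²) (d_∞ / v) + C n)`: the quadratic form
`‖∑ aₖ xₖ‖²` is a weighted sum of squares of independent sub-Gaussian variables, it concentrates at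
each point of a net of the sphere with at most `5 ^ n` points (`measureReal_weighted_sum_sq_le`), and
the net bound extends to all vectors (`half_mul_norm_sq_le_of_net`). On this event `‖wᵢ‖² ≤ 2 n / L`.

Second, the label model makes `xᵢ` independent of all the other labelled examples
(`indepFun_labelled_of_condIndepGiven`), hence of `wᵢ`. For fixed `w` with `‖w‖² ≤ 2 n / L` the
variable `⟪xᵢ, w⟫` is sub-Gaussian with parameter `2 v n / d_∞`, so `|⟪xᵢ, wᵢ⟫| ≥ 1` has probability
at most `2 exp (-d_∞ / (4 v n))`, and a union bound over `i` gives the second error term. The factor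
`2 n` is absorbed in `exp (C log n)` for `n ≥ 2`; for `n = 1` the vector `wᵢ` is `0`.
-/

open scoped RealInnerProductSpace

/-! ### A net argument for lower bounds on linear maps -/

/-- A `1`-net of cardinality at most `5 ^ dim` of the sphere of radius `2`, obtained as a maximal
`1`-separated subset. -/
theorem exists_finset_net_sphere (E : Type*) [NormedAddCommGroup E] [NormedSpace ℝ E]
    [FiniteDimensional ℝ E] :
    ∃ N : Finset E, N.card ≤ 5 ^ Module.finrank ℝ E ∧ (∀ c ∈ N, ‖c‖ = 2) ∧
      ∀ p : E, ‖p‖ = 2 → ∃ c ∈ N, ‖p - c‖ ≤ 1 := by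
  classical
  let P : Finset E → Prop := fun N =>
    (∀ c ∈ N, ‖c‖ = 2) ∧ ∀ c ∈ N, ∀ c' ∈ N, c ≠ c' → 1 ≤ ‖c - c'‖
  have hbound : ∀ N, P N → N.card ≤ 5 ^ Module.finrank ℝ E := fun N hN =>
    Besicovitch.card_le_of_separated N (fun c hc => (hN.1 c hc).le) hN.2
  let S : Set ℕ := {k | ∃ N, P N ∧ N.card = k}
  have hS : S.Nonempty := ⟨0, ∅, ⟨by simp, by simp⟩, by simp⟩
  have hSb : BddAbove S := ⟨5 ^ Module.finrank ℝ E, by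
    rintro k ⟨N, hN, rfl⟩
    exact hbound N hN⟩
  obtain ⟨N, hN, hcard⟩ := Nat.sSup_mem hS hSb
  refine ⟨N, hbound N hN, hN.1, fun p hp => ?_⟩
  by_contra! hfar
  have hpN : p ∉ N := fun h => by
    have := hfar p h
    simp at this
    linarith
  have hins : P (insert p N) := by
    refine ⟨fun c hc => ?_, fun c hc c' hc' hne => ?_⟩
    · rcases Finset.mem_insert.1 hc with rfl | hc
      exacts [hp, hN.1 c hc]
    · rcases Finset.mem_insert.1 hc with rfl | hcN <;>
        rcases Finset.mem_insert.1 hc' with rfl | hcN'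
      · exact absurd rfl hne
      · exact (hfar c' hcN').le
      · rw [norm_sub_rev]
        exact (hfar c hcN).le
      · exact hN.2 c hcN c' hcN' hne
  have hle : (insert p N).card ≤ sSup S := le_csSup hSb ⟨_, hins, rfl⟩
  rw [Finset.card_insert_of_notMem hpN, hcard] at hle
  omega

/-- If the quadratic form `‖T a‖²` is within `L / 16` of `4 L` on a `1`-net of the sphere of
radius `2`, then `‖T a‖² ≥ (L / 2) ‖a‖²` everywhere. -/
theorem half_mul_norm_sq_le_of_net {E F : Type*} [NormedAddCommGroup E] [InnerProductSpace ℝ E]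
    [FiniteDimensional ℝ E] [NormedAddCommGroup F] [InnerProductSpace ℝ F] (T : E →ₗ[ℝ] F)
    {L : ℝ} {N : Finset E} (hN : ∀ c ∈ N, ‖c‖ = 2)
    (hnet : ∀ p : E, ‖p‖ = 2 → ∃ c ∈ N, ‖p - c‖ ≤ 1)
    (hT : ∀ c ∈ N, |‖T c‖ ^ 2 - 4 * L| ≤ L / 16) (a : E) :
    L / 2 * ‖a‖ ^ 2 ≤ ‖T a‖ ^ 2 := by
  rcases eq_or_ne a 0 with rfl | ha
  · simp
  have ha' : 0 < ‖a‖ := norm_pos_iff.2 ha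
  let g : E → ℝ := fun a => ‖T a‖ ^ 2 - L * ‖a‖ ^ 2
  have hg_smul : ∀ (t : ℝ) (p : E), g (t • p) = t ^ 2 * g p := fun t p => by
    simp only [g, map_smul, norm_smul, mul_pow, Real.norm_eq_abs, sq_abs]
    ring
  have hg_cont : Continuous g := by
    have := T.continuous_of_finiteDimensional
    fun_prop
  obtain ⟨p, hp, hmax⟩ : ∃ p ∈ Metric.sphere (0 : E) 2,
      IsMaxOn (fun q => |g q|) (Metric.sphere 0 2) p :=
    (isCompact_sphere (0 : E) 2).exists_isMaxOn
      ⟨(2 / ‖a‖) • a, by simp [norm_smul, ha'.ne']⟩ hg_cont.abs.continuousOn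
  have hp2 : ‖p‖ = 2 := by simpa using hp
  set M := |g p|
  have hM0 : 0 ≤ M := abs_nonneg _
  have hg_le : ∀ q : E, |g q| ≤ M / 4 * ‖q‖ ^ 2 := fun q => by
    rcases eq_or_ne q 0 with rfl | hq
    · simp [g]
    have hq' : 0 < ‖q‖ := norm_pos_iff.2 hq
    have h1 : |g ((2 / ‖q‖) • q)| ≤ M :=
      hmax (show (2 / ‖q‖) • q ∈ Metric.sphere (0 : E) 2 by simp [norm_smul, hq'.ne'])
    rw [hg_smul, abs_mul, abs_of_nonneg (sq_nonneg _), div_pow, div_mul_eq_mul_div,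
      div_le_iff₀ (by positivity)] at h1
    linarith
  obtain ⟨c, hcN, hpc⟩ := hnet p hp2
  have hgc : |g c| ≤ L / 16 := by
    have := hT c hcN
    simp only [g, hN c hcN]
    convert this using 3
    ring
  -- `g p - g c = B (2 (p - c)) ((p + c) / 2)` for the bilinear form `B` of `g`; since
  -- `‖p + c‖² = 16 - ‖p - c‖²`, this is at most `31 / 32` of the maximum.
  have hpol : g p - g c = (g ((2 : ℝ) • (p - c) + (1 / 2 : ℝ) • (p + c)) -
      g ((2 : ℝ) • (p - c) - (1 / 2 : ℝ) • (p + c))) / 4 := by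
    simp only [g, map_add, map_sub, map_smul]
    simp only [← real_inner_self_eq_norm_sq, inner_add_left, inner_add_right, inner_sub_left,
      inner_sub_right, inner_smul_left, inner_smul_right, real_inner_comm]
    simp only [conj_trivial]
    rw [real_inner_comm c p, real_inner_comm (T c) (T p)]
    ring
  have h1 := hg_le ((2 : ℝ) • (p - c) + (1 / 2 : ℝ) • (p + c))
  have h2 := hg_le ((2 : ℝ) • (p - c) - (1 / 2 : ℝ) • (p + c))
  have hpar := parallelogram_law_with_norm ℝ ((2 : ℝ) • (p - c)) ((1 / 2 : ℝ) • (p + c))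
  have hpar' := parallelogram_law_with_norm ℝ p c
  simp only [norm_smul, hp2, hN c hcN] at hpar hpar'
  norm_num at hpar hpar'
  have hsq : ‖p - c‖ ^ 2 ≤ 1 := by
    nlinarith [norm_nonneg (p - c)]
  have hsum : ‖(2 : ℝ) • (p - c) + (1 / 2 : ℝ) • (p + c)‖ ^ 2 +
      ‖(2 : ℝ) • (p - c) - (1 / 2 : ℝ) • (p + c)‖ ^ 2 ≤ 31 / 2 := by
    norm_num
    nlinarith
  have hdiff : |g p - g c| ≤ 31 / 32 * M := by
    rw [hpol, abs_div, abs_of_pos (by norm_num : (0 : ℝ) < 4)]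
    have := abs_sub (g ((2 : ℝ) • (p - c) + (1 / 2 : ℝ) • (p + c)))
      (g ((2 : ℝ) • (p - c) - (1 / 2 : ℝ) • (p + c)))
    nlinarith
  have hMle : M ≤ 2 * L := by
    have : |g p| ≤ |g p - g c| + |g c| := by
      simpa using abs_add_le (g p - g c) (g c)
    linarith
  have hfin := (abs_le.1 (hg_le a)).1
  simp only [g] at hfin
  nlinarith [sq_nonneg ‖a‖]

/-! ### Interpolation and support vectors -/

theorem linearIndependent_of_le_norm_sq {ι E : Type*} [Fintype ι] [NormedAddCommGroup E]
    [InnerProductSpace ℝ E] {x : ι → E} {κ : ℝ} (hκ : 0 < κ)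
    (h : ∀ a : ι → ℝ, κ * ∑ k, a k ^ 2 ≤ ‖∑ k, a k • x k‖ ^ 2) : LinearIndependent ℝ x := by
  rw [Fintype.linearIndependent_iff]
  intro a ha k
  have h1 := h a
  rw [ha, norm_zero] at h1
  have h2 : ∑ k, a k ^ 2 ≤ 0 := by
    by_contra! hpos
    nlinarith [mul_pos hκ hpos]
  have h3 : a k ^ 2 ≤ ∑ k, a k ^ 2 :=
    Finset.single_le_sum (f := fun k => a k ^ 2) (fun _ _ => sq_nonneg _) (Finset.mem_univ k)
  exact pow_eq_zero_iff two_ne_zero |>.1 (le_antisymm (h3.trans h2) (sq_nonneg _))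

section Interpolation

variable {ι E : Type*} [Fintype ι] [DecidableEq ι] [NormedAddCommGroup E] [InnerProductSpace ℝ E]

/-- The coefficients `K⁻¹ y`, with `K` the Gram matrix of `x`, of the minimum norm interpolant. -/
noncomputable def interpCoeff (x : ι → E) (y : ι → ℝ) : ι → ℝ :=
  (Matrix.gram ℝ x)⁻¹ *ᵥ y

/-- The minimum norm vector `w` with `⟪x k, w⟫ = y k` for all `k`, written through the inverse Gram
matrix; it has this meaning when `x` is linearly independent. -/
noncomputable def interp (x : ι → E) (y : ι → ℝ) : E :=
  ∑ k, interpCoeff x y k • x k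

theorem inner_interp {x : ι → E} (hx : LinearIndependent ℝ x) (y : ι → ℝ) (k : ι) :
    ⟪x k, interp x y⟫ = y k := by
  have hdet : IsUnit (Matrix.gram ℝ x).det :=
    isUnit_iff_ne_zero.2 (Matrix.det_gram_ne_zero_iff_linearIndependent.2 hx)
  have h : Matrix.gram ℝ x *ᵥ interpCoeff x y = y := by
    rw [interpCoeff, Matrix.mulVec_mulVec, Matrix.mul_nonsing_inv _ hdet, Matrix.one_mulVec]
  conv_rhs => rw [← h]
  simp only [interp, inner_sum, inner_smul_right, Matrix.mulVec, dotProduct, Matrix.gram_apply]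
  exact Finset.sum_congr rfl fun l _ => mul_comm _ _

theorem norm_sq_interp_le {x : ι → E} {κ : ℝ} (hκ : 0 < κ)
    (h : ∀ a : ι → ℝ, κ * ∑ k, a k ^ 2 ≤ ‖∑ k, a k • x k‖ ^ 2) {y : ι → ℝ}
    (hy : ∀ k, y k ^ 2 = 1) : ‖interp x y‖ ^ 2 ≤ Fintype.card ι / κ := by
  have hx := linearIndependent_of_le_norm_sq hκ h
  have h1 : ‖interp x y‖ ^ 2 = ∑ k, interpCoeff x y k * y k := by
    rw [← real_inner_self_eq_norm_sq]
    change ⟪∑ k, interpCoeff x y k • x k, interp x y⟫ = _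
    simp only [sum_inner, inner_smul_left, inner_interp hx, conj_trivial]
  have h2 := Finset.sum_mul_sq_le_sq_mul_sq Finset.univ (interpCoeff x y) y
  rw [← h1] at h2
  simp only [hy, Finset.sum_const, Finset.card_univ, nsmul_eq_mul, mul_one] at h2
  have h3 := h (interpCoeff x y)
  rw [← interp] at h3
  rw [le_div_iff₀ hκ]
  rcases (sq_nonneg ‖interp x y‖).eq_or_lt with h0 | hpos
  · rw [← h0]
    simp
  · refine le_of_mul_le_mul_right ?_ hpos
    have h4 : (0 : ℝ) ≤ Fintype.card ι := by positivity
    nlinarith [mul_le_mul_of_nonneg_right h3 h4]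

end Interpolation

theorem measurable_interp {ι : Type*} [Fintype ι] [DecidableEq ι] {d : ℕ} :
    Measurable fun p : ι → EuclideanSpace ℝ (Fin d) × ℝ =>
      interp (fun k => (p k).1) (fun k => (p k).2) := by
  have hK : Continuous fun p : ι → EuclideanSpace ℝ (Fin d) × ℝ =>
      Matrix.gram ℝ fun k => (p k).1 := by
    refine continuous_matrix fun k l => ?_
    simp only [Matrix.gram_apply]
    fun_prop
  have hcoeff : ∀ k, Measurable fun p : ι → EuclideanSpace ℝ (Fin d) × ℝ =>
      interpCoeff (fun k => (p k).1) (fun k => (p k).2) k := fun k => by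
    simp only [interpCoeff, Matrix.inv_def, Ring.inverse_eq_inv', Matrix.smul_mulVec,
      Pi.smul_apply, smul_eq_mul]
    refine hK.matrix_det.measurable.inv.mul (Continuous.measurable ?_)
    have hy : Continuous fun p : ι → EuclideanSpace ℝ (Fin d) × ℝ => fun k => (p k).2 := by
      fun_prop
    exact (continuous_apply k).comp (hK.matrix_adjugate.matrix_mulVec hy)
  simp only [interp]
  refine Finset.measurable_sum _ fun k _ => (hcoeff k).smul ?_
  exact measurable_fst.comp (measurable_pi_apply k)

theorem svmDualObjective_eq {n d : ℕ} (x : Fin n → EuclideanSpace ℝ (Fin d)) (y α : Fin n → ℝ) :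
    svmDualObjective x y α = ∑ i, α i - 1 / 2 * ‖∑ i, (y i * α i) • x i‖ ^ 2 := by
  have h := Matrix.star_dotProduct_gram_mulVec (𝕜 := ℝ) x (Matrix.diagonal y *ᵥ α)
    (Matrix.diagonal y *ᵥ α)
  rw [star_trivial, real_inner_self_eq_norm_sq] at h
  simp only [Matrix.mulVec_diagonal] at h
  rw [svmDualObjective, ← h]
  congr 2
  rw [← Matrix.mulVec_mulVec, ← Matrix.mulVec_mulVec, Matrix.dotProduct_mulVec,
    Matrix.vecMul_transpose]

/-- **Leave-one-out criterion.** If each example `i` is within the margin `|⟪xᵢ, wᵢ⟫| < 1` of an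
interpolant `wᵢ` of the other examples lying in their span, then every example is a support
vector. -/
theorem isSupportVector_of_forall_abs_inner_lt_one {n d : ℕ}
    {x : Fin n → EuclideanSpace ℝ (Fin d)} {y : Fin n → ℝ} (hx : LinearIndependent ℝ x)
    (hy : ∀ k, y k = 1 ∨ y k = -1) {w : Fin n → EuclideanSpace ℝ (Fin d)}
    (hspan : ∀ i, w i ∈ Submodule.span ℝ (Set.range fun k : {k : Fin n // k ≠ i} => x k))
    (hw : ∀ i k, k ≠ i → ⟪x k, w i⟫ = y k) (hlt : ∀ i, |⟪x i, w i⟫| < 1) (i : Fin n) :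
    IsSupportVector x y i := by
  have hyy : ∀ k, y k * y k = 1 := fun k => by rcases hy k with h | h <;> simp [h]
  set u := interp x y with hu
  set β := interpCoeff x y with hβ
  have hxu : ∀ k, ⟪x k, u⟫ = y k := inner_interp hx y
  -- `u - wⱼ` is orthogonal to all `xₖ` with `k ≠ j`, so `‖u - wⱼ‖² = βⱼ (yⱼ - ⟪xⱼ, wⱼ⟫)`.
  have hnorm : ∀ j, ‖u - w j‖ ^ 2 = β j * (y j - ⟪x j, w j⟫) := fun j => by
    have horth : ∀ k, k ≠ j → ⟪x k, u - w j⟫ = 0 := fun k hk => by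
      rw [inner_sub_right, hxu, hw j k hk, sub_self]
    have hwj : ⟪w j, u - w j⟫ = 0 := by
      refine Submodule.span_induction (p := fun v _ => ⟪v, u - w j⟫ = 0) ?_ (by simp) ?_ ?_
        (hspan j)
      · rintro _ ⟨k, rfl⟩
        exact horth k k.2
      · intro a b _ _ ha hb
        rw [inner_add_left, ha, hb, add_zero]
      · intro t a _ ha
        rw [inner_smul_left, ha, mul_zero]
    rw [← real_inner_self_eq_norm_sq, inner_sub_left, hwj, sub_zero]
    change ⟪∑ k, β k • x k, u - w j⟫ = _
    rw [sum_inner, Finset.sum_eq_single j]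
    · rw [inner_smul_left, inner_sub_right, hxu]
      simp [hβ]
    · intro k _ hk
      rw [inner_smul_left, horth k hk, mul_zero]
    · simp
  have hpos : ∀ j, 0 < y j * β j := fun j => by
    have hlt' := abs_lt.1 (hlt j)
    have hne : u - w j ≠ 0 := fun h0 => by
      have h1 := hxu j
      rw [sub_eq_zero.1 h0] at h1
      rcases hy j with h | h <;> rw [h] at h1 <;> linarith
    have h2 : 0 < ‖u - w j‖ ^ 2 := by
      have := norm_pos_iff.2 hne
      positivity
    rw [hnorm j] at h2
    rcases hy j with h | h <;> rw [h] at h2 ⊢ <;> nlinarith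
  -- completing the square in the dual objective
  have hobj : ∀ a : Fin n → ℝ, svmDualObjective x y a =
      1 / 2 * ‖u‖ ^ 2 - 1 / 2 * ‖∑ k, (y k * a k) • x k - u‖ ^ 2 := fun a => by
    have hsum : ∑ k, a k = ⟪∑ k, (y k * a k) • x k, u⟫ := by
      rw [sum_inner]
      refine Finset.sum_congr rfl fun k _ => ?_
      rw [inner_smul_left, hxu, conj_trivial]
      linear_combination -a k * hyy k
    rw [svmDualObjective_eq, norm_sub_sq_real, hsum]
    ring
  have hXα : ∑ k, (y k * (y k * β k)) • x k = u := by
    rw [hu, interp]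
    refine Finset.sum_congr rfl fun k _ => ?_
    rw [← mul_assoc, hyy, one_mul]
  refine ⟨⟨fun k => y k * β k, fun k => (hpos k).le, fun a _ => ?_⟩, fun a ha => ?_⟩
  · rw [hobj a, hobj fun k => y k * β k, hXα]
    simp only [sub_self, norm_zero]
    nlinarith [sq_nonneg ‖∑ k, (y k * a k) • x k - u‖]
  · have h1 := ha.2 (fun k => y k * β k) fun k => (hpos k).le
    rw [hobj a, hobj fun k => y k * β k, hXα] at h1
    simp only [sub_self, norm_zero] at h1
    have h2 : ‖∑ k, (y k * a k) • x k - u‖ = 0 := by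
      nlinarith [sq_nonneg ‖∑ k, (y k * a k) • x k - u‖]
    rw [norm_eq_zero, sub_eq_zero, hu, interp] at h2
    have h3 := Fintype.linearIndependent_iffₛ.1 hx _ _ h2 i
    have h4 : a i = y i * β i := by
      rw [hβ, ← h3, ← mul_assoc, hyy, one_mul]
    exact h4 ▸ hpos i

/-! ### Concentration of weighted sums of squares -/

theorem lintegral_exp_sq_div_four_gaussianReal :
    ∫⁻ g, ENNReal.ofReal (Real.exp (g ^ 2 / 4)) ∂(gaussianReal 0 1) = ENNReal.ofReal √2 := by
  have hmeas : Measurable fun g : ℝ => ENNReal.ofReal (Real.exp (g ^ 2 / 4)) := by fun_prop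
  rw [gaussianReal_of_var_ne_zero _ one_ne_zero,
    lintegral_withDensity_eq_lintegral_mul _ (measurable_gaussianPDF _ _) hmeas]
  have h : ∀ g : ℝ, (gaussianPDF 0 1 * fun g => ENNReal.ofReal (Real.exp (g ^ 2 / 4))) g =
      ENNReal.ofReal ((√(2 * Real.pi))⁻¹ * Real.exp (-(1 / 4) * g ^ 2)) := fun g => by
    rw [Pi.mul_apply, gaussianPDF, ← ENNReal.ofReal_mul (gaussianPDFReal_nonneg _ _ _),
      gaussianPDFReal, mul_assoc, ← Real.exp_add]
    congr 3
    · simp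
    · simp
      ring
  simp_rw [h]
  rw [← ofReal_integral_eq_lintegral_ofReal
    ((integrable_exp_neg_mul_sq (by norm_num : (0 : ℝ) < 1 / 4)).const_mul _)
    (Filter.Eventually.of_forall fun g => by positivity), integral_const_mul, integral_gaussian]
  congr 1
  rw [← Real.sqrt_inv, ← Real.sqrt_mul (by positivity)]
  congr 1
  field_simp
  norm_num

section SubGaussianSquare

variable {Ω : Type*} [MeasurableSpace Ω] {μ : Measure Ω} [IsProbabilityMeasure μ] {X : Ω → ℝ}
  {v : ℝ≥0}

/-- Gaussian linearization: `exp (X² / (4 v))` is the integral of `exp (g X / √(2 v))` over a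
standard Gaussian `g`. -/
theorem lintegral_exp_sq_le_of_hasSubgaussianMGF (hX : Measurable X) (hv : 0 < v)
    (h : HasSubgaussianMGF X v μ) :
    ∫⁻ ω, ENNReal.ofReal (Real.exp (X ω ^ 2 / (4 * v))) ∂μ ≤ ENNReal.ofReal √2 := by
  have hv' : (0 : ℝ) < v := hv
  set s : ℝ := (√(2 * v))⁻¹ with hs
  have hs2 : s ^ 2 = (2 * (v : ℝ))⁻¹ := by
    rw [hs, inv_pow, Real.sq_sqrt (by positivity)]
  have h1 : ∀ ω, ENNReal.ofReal (Real.exp (X ω ^ 2 / (4 * v))) =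
      ∫⁻ g, ENNReal.ofReal (Real.exp (s * X ω * g)) ∂(gaussianReal 0 1) := fun ω => by
    rw [← ofReal_integral_eq_lintegral_ofReal (integrable_exp_mul_gaussianReal _)
      (Filter.Eventually.of_forall fun g => by positivity)]
    have := congrFun (mgf_id_gaussianReal (μ := 0) (v := 1)) (s * X ω)
    simp only [mgf, id_eq] at this
    rw [this, mul_pow, hs2]
    congr 2
    simp
    field_simp
    ring
  have h2 : ∀ g : ℝ, ∫⁻ ω, ENNReal.ofReal (Real.exp (s * X ω * g)) ∂μ ≤
      ENNReal.ofReal (Real.exp (g ^ 2 / 4)) := fun g => by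
    have hint := h.integrable_exp_mul (s * g)
    have hle := h.mgf_le (s * g)
    have heq : ∀ ω, s * X ω * g = s * g * X ω := fun ω => by ring
    simp_rw [heq]
    rw [← ofReal_integral_eq_lintegral_ofReal hint
      (Filter.Eventually.of_forall fun g => by positivity)]
    refine ENNReal.ofReal_le_ofReal (hle.trans_eq ?_)
    rw [mul_pow, hs2]
    congr 1
    field_simp
    ring
  simp_rw [h1]
  rw [lintegral_lintegral_swap (by fun_prop), ← lintegral_exp_sq_div_four_gaussianReal]
  exact lintegral_mono h2

theorem integrable_exp_sq_of_hasSubgaussianMGF (hX : Measurable X) (hv : 0 < v)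
    (h : HasSubgaussianMGF X v μ) : Integrable (fun ω => Real.exp (X ω ^ 2 / (4 * v))) μ := by
  refine ⟨by fun_prop, ?_⟩
  rw [hasFiniteIntegral_iff_ofReal (Filter.Eventually.of_forall fun g => by positivity)]
  exact (lintegral_exp_sq_le_of_hasSubgaussianMGF hX hv h).trans_lt ENNReal.ofReal_lt_top

theorem integral_exp_sq_le_of_hasSubgaussianMGF (hX : Measurable X) (hv : 0 < v)
    (h : HasSubgaussianMGF X v μ) : ∫ ω, Real.exp (X ω ^ 2 / (4 * v)) ∂μ ≤ 3 / 2 := by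
  have h1 := lintegral_exp_sq_le_of_hasSubgaussianMGF hX hv h
  rw [← ofReal_integral_eq_lintegral_ofReal (integrable_exp_sq_of_hasSubgaussianMGF hX hv h)
    (Filter.Eventually.of_forall fun g => by positivity),
    ENNReal.ofReal_le_ofReal_iff (by positivity)] at h1
  refine h1.trans (Real.sqrt_le_iff.2 ⟨by norm_num, by norm_num⟩)

/-- Follows from `1 + X² / (4 v) ≤ exp (X² / (4 v))`, the latter having mean at most `3 / 2`. The
sharp bound is `1 ≤ v`. -/
theorem half_le_of_hasSubgaussianMGF (hX : Measurable X) (hv : 0 < v)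
    (h : HasSubgaussianMGF X v μ) (hvar : ∫ ω, X ω ^ 2 ∂μ = 1) : (1 / 2 : ℝ) ≤ v := by
  have hv' : (0 : ℝ) < v := hv
  have hint : Integrable (fun ω => X ω ^ 2) μ := (h.memLp 2).integrable_sq
  have h1 : ∫ ω, (X ω ^ 2 / (4 * v) + 1) ∂μ ≤ ∫ ω, Real.exp (X ω ^ 2 / (4 * v)) ∂μ :=
    integral_mono ((hint.div_const _).add (integrable_const _))
      (integrable_exp_sq_of_hasSubgaussianMGF hX hv h) fun ω => Real.add_one_le_exp _
  rw [integral_add (hint.div_const _) (integrable_const _), integral_div, hvar] at h1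
  have h2 := h1.trans (integral_exp_sq_le_of_hasSubgaussianMGF hX hv h)
  simp only [integral_const, probReal_univ, smul_eq_mul, mul_one] at h2
  have h3 : 1 / (4 * (v : ℝ)) ≤ 1 / 2 := by linarith
  rw [div_le_div_iff₀ (by positivity) (by norm_num)] at h3
  linarith

theorem exp_le_one_add_add_sq_mul_exp_abs (x : ℝ) :
    Real.exp x ≤ 1 + x + x ^ 2 * Real.exp |x| := by
  have h := Complex.norm_exp_sub_sum_le_norm_mul_exp (x : ℂ) 2
  simp only [Finset.sum_range_succ, Finset.sum_range_zero] at h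
  norm_num at h
  rw [← Complex.ofReal_exp, ← Complex.ofReal_one, ← Complex.ofReal_add, ← Complex.ofReal_sub,
    Complex.norm_real, Real.norm_eq_abs] at h
  linarith [le_abs_self (Real.exp x - (1 + x))]

/-- Pointwise second order bound behind `mgf_sq_sub_one_le`: the remainder is dominated by
`exp (x² / (4 v))`, which is integrable for a sub-Gaussian variable. -/
theorem exp_mul_sq_sub_one_le {v s : ℝ} (hv : 1 / 2 ≤ v) (hs : |s| ≤ 1 / (8 * v)) (x : ℝ) :
    Real.exp (s * (x ^ 2 - 1)) ≤
      1 + s * (x ^ 2 - 1) + 256 * s ^ 2 * v ^ 2 * Real.exp (x ^ 2 / (4 * v)) := by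
  have hv0 : 0 < v := by linarith
  set τ : ℝ := 1 / (8 * v) with hτ
  have hτ0 : 0 < τ := by positivity
  have hτv : τ * v = 1 / 8 := by rw [hτ]; field_simp
  have h1 : |s * (x ^ 2 - 1)| ≤ |s| * (x ^ 2 + 1) := by
    rw [abs_mul]
    refine mul_le_mul_of_nonneg_left (abs_le.2 ⟨?_, ?_⟩) (abs_nonneg s) <;> nlinarith [sq_nonneg x]
  have h2 : |s| * (x ^ 2 + 1) ≤ τ * (x ^ 2 + 1) := by gcongr
  have h3 : (s * (x ^ 2 - 1)) ^ 2 ≤ s ^ 2 * (x ^ 2 + 1) ^ 2 := by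
    rw [← sq_abs, ← sq_abs s, ← mul_pow]
    gcongr
  have h4 : (τ * (x ^ 2 + 1)) ^ 2 ≤ 2 * Real.exp (τ * (x ^ 2 + 1)) := by
    have h0 : 0 ≤ τ * (x ^ 2 + 1) := by positivity
    linarith [Real.quadratic_le_exp_of_nonneg h0]
  have h5 : (x ^ 2 + 1) ^ 2 ≤ 128 * v ^ 2 * Real.exp (τ * (x ^ 2 + 1)) := by
    have : (x ^ 2 + 1) ^ 2 = 64 * v ^ 2 * (τ * (x ^ 2 + 1)) ^ 2 := by
      linear_combination (-64 * (x ^ 2 + 1) ^ 2 * (τ * v + 1 / 8)) * hτv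
    rw [this]
    nlinarith [sq_nonneg v]
  have h6 : Real.exp (τ * (x ^ 2 + 1)) * Real.exp (τ * (x ^ 2 + 1)) ≤
      2 * Real.exp (x ^ 2 / (4 * v)) := by
    rw [← Real.exp_add]
    have h7 : τ * (x ^ 2 + 1) + τ * (x ^ 2 + 1) = 2 * τ + x ^ 2 / (4 * v) := by
      rw [hτ]; field_simp; ring
    rw [h7, Real.exp_add]
    refine mul_le_mul_of_nonneg_right ?_ (Real.exp_pos _).le
    have h8 : 2 * τ ≤ 1 / 2 := by nlinarith
    have h9 : Real.exp (1 / 2) ≤ 2 := by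
      have := Real.exp_bound_div_one_sub_of_interval (x := 1 / 2) (by norm_num) (by norm_num)
      norm_num at this ⊢
      linarith
    exact (Real.exp_le_exp.2 h8).trans h9
  have h10 : (s * (x ^ 2 - 1)) ^ 2 * Real.exp |s * (x ^ 2 - 1)| ≤
      256 * s ^ 2 * v ^ 2 * Real.exp (x ^ 2 / (4 * v)) := by
    calc (s * (x ^ 2 - 1)) ^ 2 * Real.exp |s * (x ^ 2 - 1)|
        ≤ s ^ 2 * (128 * v ^ 2 * Real.exp (τ * (x ^ 2 + 1))) * Real.exp (τ * (x ^ 2 + 1)) := by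
          refine mul_le_mul (h3.trans ?_) (Real.exp_le_exp.2 (h1.trans h2)) (Real.exp_pos _).le
            (by positivity)
          exact mul_le_mul_of_nonneg_left h5 (sq_nonneg s)
      _ = 128 * s ^ 2 * v ^ 2 *
          (Real.exp (τ * (x ^ 2 + 1)) * Real.exp (τ * (x ^ 2 + 1))) := by ring
      _ ≤ 128 * s ^ 2 * v ^ 2 * (2 * Real.exp (x ^ 2 / (4 * v))) :=
          mul_le_mul_of_nonneg_left h6 (by positivity)
      _ = _ := by ring
  linarith [exp_le_one_add_add_sq_mul_exp_abs (s * (x ^ 2 - 1))]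

theorem integrable_exp_mul_sq_sub_one (hX : Measurable X) (hv : 0 < v)
    (h : HasSubgaussianMGF X v μ) {s : ℝ} (hs : |s| ≤ 1 / (8 * v)) :
    Integrable (fun ω => Real.exp (s * (X ω ^ 2 - 1))) μ := by
  have hv' : (0 : ℝ) < v := hv
  refine ((integrable_exp_sq_of_hasSubgaussianMGF hX hv h).const_mul
    (Real.exp (1 / (8 * v)))).mono' (by fun_prop) (Filter.Eventually.of_forall fun ω => ?_)
  rw [Real.norm_eq_abs, Real.abs_exp, ← Real.exp_add]
  refine Real.exp_le_exp.2 ?_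
  have h1 := abs_le.1 hs
  have h2 : X ω ^ 2 / (4 * v) = 2 * (1 / (8 * v) * X ω ^ 2) := by field_simp; ring
  have h3 : (0 : ℝ) < 1 / (8 * v) := by positivity
  nlinarith [sq_nonneg (X ω)]

/-- The centered square of a unit variance sub-Gaussian variable is sub-exponential. -/
theorem mgf_sq_sub_one_le (hX : Measurable X) (hv : 0 < v) (h : HasSubgaussianMGF X v μ)
    (hvar : ∫ ω, X ω ^ 2 ∂μ = 1) {s : ℝ} (hs : |s| ≤ 1 / (8 * v)) :
    mgf (fun ω => X ω ^ 2 - 1) μ s ≤ Real.exp (384 * s ^ 2 * v ^ 2) := by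
  have hhalf := half_le_of_hasSubgaussianMGF hX hv h hvar
  have hint : Integrable (fun ω => X ω ^ 2) μ := (h.memLp 2).integrable_sq
  have hexp := integrable_exp_sq_of_hasSubgaussianMGF hX hv h
  have hsub : Integrable (fun ω => X ω ^ 2 - 1) μ := hint.sub (integrable_const _)
  have hlin : Integrable (fun ω => 1 + s * (X ω ^ 2 - 1)) μ :=
    (integrable_const _).add (hsub.const_mul s)
  calc mgf (fun ω => X ω ^ 2 - 1) μ s
      ≤ ∫ ω, (1 + s * (X ω ^ 2 - 1) +
          256 * s ^ 2 * v ^ 2 * Real.exp (X ω ^ 2 / (4 * v))) ∂μ :=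
        integral_mono (integrable_exp_mul_sq_sub_one hX hv h hs) (hlin.add (hexp.const_mul _))
          fun ω => exp_mul_sq_sub_one_le hhalf hs (X ω)
    _ = 1 + 256 * s ^ 2 * v ^ 2 * ∫ ω, Real.exp (X ω ^ 2 / (4 * v)) ∂μ := by
        rw [integral_add hlin (hexp.const_mul _), integral_const_mul,
          integral_add (integrable_const _) (hsub.const_mul s),
          integral_const_mul, integral_sub hint (integrable_const _), hvar]
        simp
    _ ≤ 1 + 384 * s ^ 2 * v ^ 2 := by
        have := mul_le_mul_of_nonneg_left (integral_exp_sq_le_of_hasSubgaussianMGF hX hv h)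
          (by positivity : 0 ≤ 256 * s ^ 2 * (v : ℝ) ^ 2)
        linarith
    _ ≤ _ := by linarith [Real.add_one_le_exp (384 * s ^ 2 * (v : ℝ) ^ 2)]

end SubGaussianSquare

/-- Independence of a family indexed by pairs gives independence of its blocks. -/
theorem iIndepFun_curry {Ω ι κ α : Type*} [MeasurableSpace Ω] [MeasurableSpace α] {μ : Measure Ω}
    {X : ι → κ → Ω → α} (hX : ∀ i j, Measurable (X i j))
    (h : iIndepFun (fun p : ι × κ => X p.1 p.2) μ) : iIndepFun (fun i ω j => X i j ω) μ := by
  have := h.isProbabilityMeasure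
  have hprob : ∀ i j, IsProbabilityMeasure (μ.map (X i j)) :=
    fun i j => Measure.isProbabilityMeasure_map (hX i j).aemeasurable
  have h' : iIndepFun (fun p : (_ : ι) × κ => X p.1 p.2) μ :=
    h.precomp (Equiv.sigmaEquivProd ι κ).injective
  have h2 : ∀ i, iIndepFun (X i) μ := fun i =>
    h.precomp (g := fun j => (i, j)) fun j j' hj => (Prod.mk.inj hj).2
  rw [iIndepFun_iff_map_fun_eq_infinitePi_map (by fun_prop)] at h' ⊢
  have hcomp : (fun ω i j => X i j ω) =
      (MeasurableEquiv.piCurry fun (_ : ι) (_ : κ) => α) ∘ fun ω p => X p.1 p.2 ω := by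
    ext
    simp [Sigma.curry]
  rw [hcomp, ← Measure.map_map (by fun_prop) (by fun_prop), h',
    Measure.infinitePi_map_piCurry fun i j => μ.map (X i j)]
  congrm Measure.infinitePi fun i => ?_
  exact ((iIndepFun_iff_map_fun_eq_infinitePi_map (by fun_prop)).1 (h2 i)).symm

section WeightedSum

variable {Ω : Type*} [MeasurableSpace Ω] {μ : Measure Ω} [IsProbabilityMeasure μ]
  {d : ℕ} {Y : Fin d → Ω → ℝ} {v : ℝ≥0} {lam : Fin d → ℝ}

theorem abs_mul_le_of_abs_le_div_norm (hlam : lam ≠ 0) (hv : 0 < v) {t : ℝ}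
    (ht : |t| ≤ 1 / (8 * v * ‖lam‖)) (j : Fin d) : |t * lam j| ≤ 1 / (8 * v) := by
  have hv' : (0 : ℝ) < v := hv
  have hΛ : 0 < ‖lam‖ := norm_pos_iff.2 hlam
  have h1 : |lam j| ≤ ‖lam‖ := norm_le_pi_norm lam j
  rw [abs_mul]
  calc |t| * |lam j| ≤ 1 / (8 * v * ‖lam‖) * ‖lam‖ := by gcongr
    _ = 1 / (8 * v) := by field_simp

theorem integrable_exp_mul_weighted_sum (hYm : ∀ j, Measurable (Y j)) (hind : iIndepFun Y μ)
    (hv : 0 < v) (hY : ∀ j, HasSubgaussianMGF (Y j) v μ) (hlam : lam ≠ 0) {t : ℝ}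
    (ht : |t| ≤ 1 / (8 * v * ‖lam‖)) :
    Integrable (fun ω => Real.exp (t * ∑ j, lam j * (Y j ω ^ 2 - 1))) μ := by
  have hindW : iIndepFun (fun j ω => lam j * (Y j ω ^ 2 - 1)) μ :=
    hind.comp (fun j x => lam j * (x ^ 2 - 1)) fun j => by fun_prop
  have := hindW.integrable_exp_mul_sum (t := t) (fun j => by fun_prop) (s := Finset.univ)
    fun j _ => by
      have := integrable_exp_mul_sq_sub_one (hYm j) hv (hY j)
        (abs_mul_le_of_abs_le_div_norm hlam hv ht j)
      simpa only [mul_assoc] using this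
  simpa only [Finset.sum_apply] using this

theorem mgf_weighted_sum_le (hYm : ∀ j, Measurable (Y j)) (hind : iIndepFun Y μ)
    (hv : 0 < v) (hY : ∀ j, HasSubgaussianMGF (Y j) v μ) (hvar : ∀ j, ∫ ω, Y j ω ^ 2 ∂μ = 1)
    (hlam : lam ≠ 0) {t : ℝ} (ht : |t| ≤ 1 / (8 * v * ‖lam‖)) :
    mgf (fun ω => ∑ j, lam j * (Y j ω ^ 2 - 1)) μ t ≤
      Real.exp (384 * t ^ 2 * v ^ 2 * ∑ j, lam j ^ 2) := by
  have hindW : iIndepFun (fun j ω => lam j * (Y j ω ^ 2 - 1)) μ :=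
    hind.comp (fun j x => lam j * (x ^ 2 - 1)) fun j => by fun_prop
  have h := hindW.mgf_sum (t := t) (fun j => by fun_prop) Finset.univ
  have hsum : (∑ j, fun ω => lam j * (Y j ω ^ 2 - 1)) =
      fun ω => ∑ j, lam j * (Y j ω ^ 2 - 1) := by
    ext ω
    simp
  rw [hsum] at h
  rw [h, Finset.mul_sum, Real.exp_sum]
  refine Finset.prod_le_prod (fun _ _ => mgf_nonneg) fun j _ => ?_
  have := mgf_sq_sub_one_le (hYm j) hv (hY j) (hvar j)
    (abs_mul_le_of_abs_le_div_norm hlam hv ht j)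
  rw [mgf_const_mul, mul_comm (lam j) t]
  refine this.trans_eq ?_
  ring_nf

/-- Bernstein-type bound at relative deviation `1 / 64`: with `L = ∑ λⱼ`, the weighted sum of
squares deviates from its mean `L` by `L / 64` with probability exponentially small in
`min (d₂ / v²) (d_∞ / v)`. -/
theorem measureReal_weighted_sum_sq_le (hYm : ∀ j, Measurable (Y j)) (hind : iIndepFun Y μ)
    (hv : 0 < v) (hY : ∀ j, HasSubgaussianMGF (Y j) v μ) (hvar : ∀ j, ∫ ω, Y j ω ^ 2 ∂μ = 1)
    (hlam0 : lam ≠ 0) (hlam : ∀ j, 0 ≤ lam j) :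
    μ.real {ω | (∑ j, lam j) / 64 ≤ |∑ j, lam j * Y j ω ^ 2 - ∑ j, lam j|} ≤
      2 * Real.exp (-(1 / 6291456) *
        min (effDimTwo lam / (v : ℝ) ^ 2) (effDimInf lam / (v : ℝ))) := by
  have hv' : (0 : ℝ) < v := hv
  have hΛ : 0 < ‖lam‖ := norm_pos_iff.2 hlam0
  set L := ∑ j, lam j with hL
  set Q := ∑ j, lam j ^ 2 with hQ
  have habs : ∑ j, |lam j| = L := Finset.sum_congr rfl fun j _ => abs_of_nonneg (hlam j)
  obtain ⟨j₀, hj₀⟩ := Function.ne_iff.1 hlam0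
  have hQ0 : 0 < Q :=
    Finset.sum_pos' (fun j _ => sq_nonneg _) ⟨j₀, Finset.mem_univ _, pow_pos
      ((hlam j₀).lt_of_ne' hj₀) 2⟩
  have hL0 : 0 < L :=
    Finset.sum_pos' (fun j _ => hlam j) ⟨j₀, Finset.mem_univ _, (hlam j₀).lt_of_ne' hj₀⟩
  -- the minimizer of `-t L / 64 + 384 t² v² Q`, truncated to the range of the moment bound
  set t := min (L / (49152 * v ^ 2 * Q)) (1 / (8 * v * ‖lam‖)) with ht
  have ht0 : 0 < t := lt_min (by positivity) (by positivity)
  have ht1 : |t| ≤ 1 / (8 * v * ‖lam‖) := by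
    rw [abs_of_pos ht0]
    exact min_le_right _ _
  have ht1' : |-t| ≤ 1 / (8 * v * ‖lam‖) := by rwa [abs_neg]
  have ht2 : t * (49152 * v ^ 2 * Q) ≤ L := by
    rw [← le_div_iff₀ (by positivity)]
    exact min_le_left _ _
  have ht3 : t * L / 128 =
      1 / 6291456 * min (effDimTwo lam / (v : ℝ) ^ 2) (6144 * (effDimInf lam / (v : ℝ))) := by
    rw [effDimTwo, effDimInf, habs, ← hQ, ht, mul_min_of_nonneg _ _ (by norm_num), div_eq_mul_inv,
      mul_assoc, min_mul_of_nonneg _ _ (by positivity)]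
    congr 1
    · field_simp
      norm_num
    · field_simp
      norm_num
  have ht4 : 1 / 6291456 * min (effDimTwo lam / (v : ℝ) ^ 2) (effDimInf lam / (v : ℝ)) ≤
      t * L / 128 := by
    rw [ht3]
    have : 0 ≤ effDimInf lam / (v : ℝ) := by
      rw [effDimInf]
      positivity
    refine mul_le_mul_of_nonneg_left (min_le_min_left _ ?_) (by norm_num)
    linarith
  set Z : Ω → ℝ := fun ω => ∑ j, lam j * (Y j ω ^ 2 - 1) with hZ
  have hexpo : ∀ s : ℝ, s ^ 2 = t ^ 2 →
      -t * (L / 64) + 384 * s ^ 2 * v ^ 2 * Q ≤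
        -(1 / 6291456) * min (effDimTwo lam / (v : ℝ) ^ 2) (effDimInf lam / (v : ℝ)) := by
    intro s hs
    rw [hs]
    nlinarith [mul_le_mul_of_nonneg_left ht2 ht0.le]
  have hup : μ.real {ω | L / 64 ≤ Z ω} ≤ Real.exp (-(1 / 6291456) *
      min (effDimTwo lam / (v : ℝ) ^ 2) (effDimInf lam / (v : ℝ))) := by
    refine (measure_ge_le_exp_mul_mgf (L / 64) ht0.le
      (integrable_exp_mul_weighted_sum hYm hind hv hY hlam0 ht1)).trans ?_
    refine (mul_le_mul_of_nonneg_left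
      (mgf_weighted_sum_le hYm hind hv hY hvar hlam0 ht1) (Real.exp_pos _).le).trans ?_
    rw [← Real.exp_add]
    exact Real.exp_le_exp.2 (hexpo t rfl)
  have hlow : μ.real {ω | Z ω ≤ -(L / 64)} ≤ Real.exp (-(1 / 6291456) *
      min (effDimTwo lam / (v : ℝ) ^ 2) (effDimInf lam / (v : ℝ))) := by
    refine (measure_le_le_exp_mul_mgf (-(L / 64)) (neg_nonpos.2 ht0.le)
      (integrable_exp_mul_weighted_sum hYm hind hv hY hlam0 ht1')).trans ?_
    refine (mul_le_mul_of_nonneg_left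
      (mgf_weighted_sum_le hYm hind hv hY hvar hlam0 ht1') (Real.exp_pos _).le).trans ?_
    rw [← Real.exp_add]
    refine Real.exp_le_exp.2 ((le_of_eq ?_).trans (hexpo (-t) (neg_sq t)))
    ring
  have hsub : {ω | L / 64 ≤ |∑ j, lam j * Y j ω ^ 2 - L|} ⊆
      {ω | L / 64 ≤ Z ω} ∪ {ω | Z ω ≤ -(L / 64)} := by
    intro ω hω
    have hZω : Z ω = ∑ j, lam j * Y j ω ^ 2 - L := by
      simp only [hZ, hL, mul_sub, mul_one, Finset.sum_sub_distrib]
    simp only [Set.mem_ofPred_eq, Set.mem_union] at hω ⊢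
    rw [hZω]
    rcases le_abs.1 hω with h | h
    · exact Or.inl h
    · exact Or.inr (by linarith)
  calc _ ≤ _ := measureReal_mono hsub
    _ ≤ _ := measureReal_union_le _ _
    _ ≤ _ := by linarith

end WeightedSum

section Combination

variable {Ω ι : Type*} [MeasurableSpace Ω] [Fintype ι] {μ : Measure Ω}
  {X : ι → Ω → ℝ} {v : ℝ≥0}

theorem hasSubgaussianMGF_sum_mul (hind : iIndepFun X μ) (h : ∀ i, HasSubgaussianMGF (X i) v μ)
    (u : ι → ℝ) {w : ℝ≥0} (hw : v * ∑ i, u i ^ 2 ≤ w) :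
    HasSubgaussianMGF (fun ω => ∑ i, u i * X i ω) w μ := by
  let c : ι → ℝ≥0 := fun i => NNReal.mk (u i ^ 2) (sq_nonneg (u i)) * v
  have h1 := HasSubgaussianMGF.sum_of_iIndepFun (s := Finset.univ)
    (hind.comp (fun i x => u i * x) fun i => by fun_prop)
    (c := c) (fun i _ => (h i).const_mul (u i))
  refine ⟨h1.integrable_exp_mul, fun t => (h1.mgf_le t).trans (Real.exp_le_exp.2 ?_)⟩
  have h2 : ((∑ i, c i : ℝ≥0) : ℝ) = v * ∑ i, u i ^ 2 := by
    rw [NNReal.coe_sum, Finset.mul_sum]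
    refine Finset.sum_congr rfl fun i _ => ?_
    simp [c, mul_comm]
  rw [h2]
  have := mul_le_mul_of_nonneg_right hw (sq_nonneg t)
  linarith

theorem integral_sum_mul_sq (hind : iIndepFun X μ) (hX : ∀ i, MemLp (X i) 2 μ)
    (hmean : ∀ i, ∫ ω, X i ω ∂μ = 0) (hvar : ∀ i, ∫ ω, X i ω ^ 2 ∂μ = 1) (u : ι → ℝ) :
    ∫ ω, (∑ i, u i * X i ω) ^ 2 ∂μ = ∑ i, u i ^ 2 := by
  classical
  have hcov : ∀ i j, ∫ ω, X i ω * X j ω ∂μ = if i = j then 1 else 0 := fun i j => by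
    split_ifs with hij
    · subst hij
      simpa only [sq] using hvar i
    · have := (hind.indepFun hij).integral_mul_eq_mul_integral (hX i).1 (hX j).1
      simpa only [Pi.mul_apply, hmean, mul_zero] using this
  have hint : ∀ i j, Integrable (fun ω => u i * X i ω * (u j * X j ω)) μ := fun i j =>
    ((hX i).const_mul (u i)).integrable_mul ((hX j).const_mul (u j))
  simp_rw [sq, Finset.sum_mul_sum]
  rw [integral_finsetSum _ fun i _ => integrable_finsetSum _ fun j _ => hint i j]
  refine Finset.sum_congr rfl fun i _ => ?_
  rw [integral_finsetSum _ fun j _ => hint i j]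
  have : ∀ j, ∫ ω, u i * X i ω * (u j * X j ω) ∂μ = if i = j then u i * u j else 0 := fun j => by
    have h1 : ∀ ω, u i * X i ω * (u j * X j ω) = u i * u j * (X i ω * X j ω) := fun ω => by ring
    simp_rw [h1]
    rw [integral_const_mul, hcov]
    split_ifs <;> simp
  simp [this]

end Combination

/-! ### Independence of an example from the other labelled examples -/

section Labels

variable {α β γ : Type*} [MeasurableSpace α] [MeasurableSpace β] [MeasurableSpace γ]

/-- The identity for boxes `A ×ˢ t`, which is conditional independence, extends to all measurable
`D` by a `π`-`λ` argument. The σ-algebra `m` is kept as a variable so that it is not confused with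
the ambient one. -/
theorem measureReal_inter_eq_setIntegral_condExp {Ω : Type*} {m : MeasurableSpace Ω}
    [MeasurableSpace Ω] {μ : Measure Ω} [IsProbabilityMeasure μ] {X : Ω → α} {Y : Ω → β}
    {Z : Ω → γ} (hX : Measurable X) (hY : Measurable Y) (hZ : Measurable Z)
    (hm : m = MeasurableSpace.comap X inferInstance) (h : CondIndepGiven m Y Z μ) {s : Set β}
    (hs : MeasurableSet s) {D : Set (α × γ)} (hD : MeasurableSet D) :
    μ.real ((fun ω => (X ω, Z ω)) ⁻¹' D ∩ Y ⁻¹' s) =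
      ∫ ω in (fun ω => (X ω, Z ω)) ⁻¹' D, (μ⟦Y ⁻¹' s | m⟧) ω ∂μ := by
  have hle : m ≤ ‹MeasurableSpace Ω› := hm ▸ hX.comap_le
  set p : Ω → ℝ := μ⟦Y ⁻¹' s | m⟧
  have hXZ : Measurable fun ω => (X ω, Z ω) := hX.prodMk hZ
  have hYs : MeasurableSet (Y ⁻¹' s) := hY hs
  have hp_int : Integrable p μ := integrable_condExp
  -- boxes are the case given by conditional independence
  have hbox : ∀ (A : Set α) (t : Set γ), MeasurableSet A → MeasurableSet t →
      μ.real ((fun ω => (X ω, Z ω)) ⁻¹' (A ×ˢ t) ∩ Y ⁻¹' s) =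
        ∫ ω in (fun ω => (X ω, Z ω)) ⁻¹' (A ×ˢ t), p ω ∂μ := by
    intro A t hA ht
    have hZt : MeasurableSet (Z ⁻¹' t) := hZ ht
    have hAm : MeasurableSet[m] (X ⁻¹' A) := hm ▸ ⟨A, hA, rfl⟩
    have hA' : MeasurableSet (X ⁻¹' A) := hX hA
    have hpre : (fun ω => (X ω, Z ω)) ⁻¹' (A ×ˢ t) = X ⁻¹' A ∩ Z ⁻¹' t := rfl
    have h1 : ∫ ω in X ⁻¹' A, (Y ⁻¹' s ∩ Z ⁻¹' t).indicator (fun _ => (1 : ℝ)) ω ∂μ =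
        μ.real (X ⁻¹' A ∩ Z ⁻¹' t ∩ Y ⁻¹' s) := by
      rw [setIntegral_indicator (hYs.inter hZt), setIntegral_const, smul_eq_mul, mul_one]
      congr 1
      ext ω
      simp only [Set.mem_inter_iff]
      tauto
    have h2 : ∫ ω in X ⁻¹' A, (Y ⁻¹' s ∩ Z ⁻¹' t).indicator (fun _ => (1 : ℝ)) ω ∂μ =
        ∫ ω in X ⁻¹' A, (p * μ⟦Z ⁻¹' t | m⟧) ω ∂μ := by
      rw [← setIntegral_condExp hle ((integrable_const _).indicator (hYs.inter hZt)) hAm]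
      exact setIntegral_congr_ae hA' ((h s t hs ht).mono fun ω hω _ => hω)
    have hind : Integrable ((Z ⁻¹' t).indicator fun _ => (1 : ℝ)) μ :=
      (integrable_const _).indicator hZt
    have hpi : Integrable (p * (Z ⁻¹' t).indicator fun _ => (1 : ℝ)) μ := by
      have : p * (Z ⁻¹' t).indicator (fun _ => (1 : ℝ)) = (Z ⁻¹' t).indicator p := by
        ext ω
        by_cases hω : ω ∈ Z ⁻¹' t <;> simp [hω]
      rw [this]
      exact hp_int.indicator hZt
    have h3 : ∫ ω in X ⁻¹' A, (p * μ⟦Z ⁻¹' t | m⟧) ω ∂μ =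
        ∫ ω in X ⁻¹' A, (p * (Z ⁻¹' t).indicator fun _ => (1 : ℝ)) ω ∂μ := by
      rw [← setIntegral_condExp hle hpi hAm]
      refine setIntegral_congr_ae hA' ?_
      filter_upwards [condExp_mul_of_stronglyMeasurable_left
        (stronglyMeasurable_condExp (m := m) (μ := μ)) hpi hind] with ω hω _
      exact hω.symm
    have h4 : ∫ ω in X ⁻¹' A, (p * (Z ⁻¹' t).indicator fun _ => (1 : ℝ)) ω ∂μ =
        ∫ ω in X ⁻¹' A ∩ Z ⁻¹' t, p ω ∂μ := by
      rw [← setIntegral_indicator hZt]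
      refine integral_congr_ae (Filter.Eventually.of_forall fun ω => ?_)
      by_cases hω : ω ∈ Z ⁻¹' t <;> simp [hω]
    rw [hpre, ← h1, h2, h3, h4]
  have hmul : ∀ D : Set (α × γ), MeasurableSet D →
      MeasurableSet ((fun ω => (X ω, Z ω)) ⁻¹' D) := fun D hD => hXZ hD
  refine MeasurableSpace.induction_on_inter (C := fun D _ =>
    μ.real ((fun ω => (X ω, Z ω)) ⁻¹' D ∩ Y ⁻¹' s) =
      ∫ ω in (fun ω => (X ω, Z ω)) ⁻¹' D, p ω ∂μ) generateFrom_prod.symm isPiSystem_prod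
    (by simp) ?_ ?_ ?_ D hD
  · rintro - ⟨A, hA, t, ht, rfl⟩
    exact hbox A t hA ht
  · intro D hD hDe
    have huniv := hbox Set.univ Set.univ .univ .univ
    simp only [Set.univ_prod_univ, Set.preimage_univ, Set.univ_inter, setIntegral_univ] at huniv
    have h1 := integral_add_compl (hmul D hD) hp_int
    have h2 := measureReal_inter_add_sdiff (μ := μ) (s := Y ⁻¹' s) (hmul D hD)
    rw [Set.inter_comm, hDe] at h2
    have h3 : (fun ω => (X ω, Z ω)) ⁻¹' Dᶜ ∩ Y ⁻¹' s =
        Y ⁻¹' s \ (fun ω => (X ω, Z ω)) ⁻¹' D := by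
      rw [Set.preimage_compl, Set.inter_comm, Set.sdiff_eq]
    rw [h3, Set.preimage_compl]
    linarith
  · intro f hdisj hf hfe
    have hdisj' : Pairwise (Function.onFun Disjoint fun i => (fun ω => (X ω, Z ω)) ⁻¹' f i) :=
      fun i j hij => (hdisj hij).preimage _
    rw [Set.preimage_iUnion, integral_iUnion (fun i => hmul _ (hf i)) hdisj'
      hp_int.integrableOn, Set.iUnion_inter]
    simp_rw [← hfe]
    rw [measureReal_def, measure_iUnion (fun i j hij => (hdisj' hij).mono Set.inter_subset_left
      Set.inter_subset_left) fun i => (hmul _ (hf i)).inter hYs, ENNReal.tsum_toReal_eq fun i =>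
      measure_ne_top _ _]
    rfl

variable {Ω : Type*} [MeasurableSpace Ω] {μ : Measure Ω} [IsProbabilityMeasure μ]

/-- If `Y` and `Z` are conditionally independent given `X`, then the conditional probability of
`Y ∈ s` given `(X, Z)` is a function `q` of `X` alone. -/
theorem exists_measureReal_inter_eq_setIntegral {X : Ω → α} {Y : Ω → β} {Z : Ω → γ}
    (hX : Measurable X) (hY : Measurable Y) (hZ : Measurable Z)
    (h : CondIndepGiven (MeasurableSpace.comap X inferInstance) Y Z μ) {s : Set β}
    (hs : MeasurableSet s) :
    ∃ q : α → ℝ, Measurable q ∧ ∀ D : Set (α × γ), MeasurableSet D →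
      μ.real ((fun ω => (X ω, Z ω)) ⁻¹' D ∩ Y ⁻¹' s) =
        ∫ ω in (fun ω => (X ω, Z ω)) ⁻¹' D, q (X ω) ∂μ := by
  have hp : StronglyMeasurable[MeasurableSpace.comap X inferInstance]
      (μ⟦Y ⁻¹' s | MeasurableSpace.comap X inferInstance⟧) := stronglyMeasurable_condExp
  obtain ⟨q, hq, hqp⟩ := hp.exists_eq_measurable_comp
  refine ⟨q, hq.measurable, fun D hD => ?_⟩
  rw [measureReal_inter_eq_setIntegral_condExp hX hY hZ rfl h hs hD, hqp]
  rfl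

/-- A variable `U` independent of `V` is independent of `(V, Y)` when, given a function `a V` of
`V`, `Y` is conditionally independent of some `Z` which determines `(U, V)` together with `a V`. -/
theorem IndepFun.prodMk_of_condIndepGiven {δ ε : Type*} [MeasurableSpace δ] [MeasurableSpace ε]
    {U : Ω → δ} {V : Ω → ε} {Y : Ω → β} {Z : Ω → γ} {a : ε → α} {g : α × γ → δ × ε}
    (hU : Measurable U) (hV : Measurable V) (hY : Measurable Y) (hZ : Measurable Z)
    (ha : Measurable a) (hg : Measurable g) (hgUV : ∀ ω, g (a (V ω), Z ω) = (U ω, V ω))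
    (hUV : IndepFun U V μ)
    (h : CondIndepGiven (MeasurableSpace.comap (fun ω => a (V ω)) inferInstance) Y Z μ) :
    IndepFun U (fun ω => (V ω, Y ω)) μ := by
  have hX : Measurable fun ω => a (V ω) := ha.comp hV
  rw [indepFun_iff_map_prod_eq_prod_map_map hU.aemeasurable (hV.prodMk hY).aemeasurable]
  have hprob : IsProbabilityMeasure (μ.map fun ω => (U ω, V ω, Y ω)) :=
    Measure.isProbabilityMeasure_map (hU.prodMk (hV.prodMk hY)).aemeasurable
  refine Measure.ext_prod₃ fun {A B s} hA hB hs => ?_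
  rw [Measure.prod_prod, Measure.map_apply (hU.prodMk (hV.prodMk hY)) (hA.prod (hB.prod hs)),
    Measure.map_apply hU hA, Measure.map_apply (hV.prodMk hY) (hB.prod hs),
    ← ENNReal.toReal_eq_toReal_iff' (measure_ne_top _ _)
      (ENNReal.mul_ne_top (measure_ne_top _ _) (measure_ne_top _ _)), ENNReal.toReal_mul]
  change μ.real _ = μ.real _ * μ.real _
  obtain ⟨q, hq, hqD⟩ := exists_measureReal_inter_eq_setIntegral hX hY hZ h hs
  have key : ∀ A : Set δ, MeasurableSet A →
      μ.real ((fun ω => (U ω, V ω, Y ω)) ⁻¹' (A ×ˢ B ×ˢ s)) =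
        ∫ ω, A.indicator (fun _ => (1 : ℝ)) (U ω) * B.indicator (fun v => q (a v)) (V ω) ∂μ := by
    intro A hA
    have hpre : (fun ω => (a (V ω), Z ω)) ⁻¹' (g ⁻¹' (A ×ˢ B)) = U ⁻¹' A ∩ V ⁻¹' B := by
      ext ω
      simp only [Set.mem_preimage, hgUV, Set.mem_prod, Set.mem_inter_iff]
    have h1 := hqD (g ⁻¹' (A ×ˢ B)) (hg (hA.prod hB))
    rw [hpre] at h1
    have h2 : (fun ω => (U ω, V ω, Y ω)) ⁻¹' (A ×ˢ B ×ˢ s) = U ⁻¹' A ∩ V ⁻¹' B ∩ Y ⁻¹' s := by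
      ext ω
      simp only [Set.mem_preimage, Set.mem_prod, Set.mem_inter_iff, and_assoc]
    rw [h2, h1, ← integral_indicator ((hU hA).inter (hV hB))]
    refine integral_congr_ae (Filter.Eventually.of_forall fun ω => ?_)
    by_cases hωA : U ω ∈ A <;> by_cases hωB : V ω ∈ B <;> simp [hωA, hωB]
  have hmeasA : Measurable (A.indicator fun _ => (1 : ℝ)) := measurable_const.indicator hA
  have hmeasB : Measurable (B.indicator fun v => q (a v)) := (hq.comp ha).indicator hB
  have hprod := (hUV.comp hmeasA hmeasB).integral_mul_eq_mul_integral
    (hmeasA.comp hU).aestronglyMeasurable (hmeasB.comp hV).aestronglyMeasurable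
  simp only [Pi.mul_apply, Function.comp_apply] at hprod
  have hA1 : ∫ ω, A.indicator (fun _ => (1 : ℝ)) (U ω) ∂μ = μ.real (U ⁻¹' A) := by
    rw [← integral_indicator_one (hU hA)]
    rfl
  have hB1 : ∫ ω, B.indicator (fun v => q (a v)) (V ω) ∂μ =
      μ.real ((fun ω => (V ω, Y ω)) ⁻¹' (B ×ˢ s)) := by
    have h3 := key Set.univ .univ
    simp only [Set.indicator_univ, one_mul] at h3
    rw [← h3]
    congr 1
    ext ω
    simp
  rw [key A hA, hprod, hA1, hB1]

/-- If the features `x` are such that `x i` is independent of the other features, and each label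
is conditionally independent of all other examples given its own feature, then `x i` is
independent of all other labelled examples. The labels are revealed one at a time. -/
theorem indepFun_labelled_of_condIndepGiven {n : ℕ} {x : Fin n → Ω → α} {y : Fin n → Ω → ℝ}
    (hx : ∀ k, Measurable (x k)) (hy : ∀ k, Measurable (y k))
    (h : ∀ k, CondIndepGiven (MeasurableSpace.comap (x k) inferInstance) (y k)
      (fun ω (j : {j : Fin n // j ≠ k}) => (x j ω, y j ω)) μ) (i : Fin n)
    (hind : IndepFun (x i) (fun ω (k : {k : Fin n // k ≠ i}) => x k ω) μ) :
    IndepFun (x i) (fun ω (k : {k : Fin n // k ≠ i}) => (x k ω, y k ω)) μ := by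
  classical
  suffices H : ∀ T : Finset {k : Fin n // k ≠ i},
      IndepFun (x i)
      (fun ω (k : {k : Fin n // k ≠ i}) => (x k ω, if k ∈ T then y k ω else 0)) μ by
    simpa using H Finset.univ
  intro T
  induction T using Finset.induction_on with
  | empty =>
    exact hind.comp measurable_id (ψ := fun v k => (v k, (0 : ℝ))) (by fun_prop)
  | insert j T hj ih =>
    set V : Ω → {k : Fin n // k ≠ i} → α × ℝ :=
      fun ω k => (x k ω, if k ∈ T then y k ω else 0) with hV
    have hVm : Measurable V := by
      refine measurable_pi_lambda _ fun k => (hx k).prodMk ?_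
      split_ifs
      exacts [hy k, measurable_const]
    let g : α × ({l : Fin n // l ≠ j} → α × ℝ) → α × ({k : Fin n // k ≠ i} → α × ℝ) :=
      fun p => ((p.2 ⟨i, j.2.symm⟩).1, fun k =>
        if hk : (k : Fin n) = j then (p.1, 0)
        else ((p.2 ⟨k, hk⟩).1, if k ∈ T then (p.2 ⟨k, hk⟩).2 else 0))
    have hg : Measurable g := by
      refine Measurable.prodMk (by fun_prop) (measurable_pi_lambda _ fun k => ?_)
      split_ifs <;> fun_prop
    have hstep := IndepFun.prodMk_of_condIndepGiven (U := x i) (V := V) (Y := y j)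
      (Z := fun ω (l : {l : Fin n // l ≠ j}) => (x l ω, y l ω)) (a := fun v => (v j).1) (g := g)
      (hx i) hVm (hy j) (by fun_prop) (by fun_prop) hg (fun ω => by
        refine Prod.ext rfl (funext fun k => ?_)
        by_cases hk : (k : Fin n) = j
        · obtain rfl : k = j := Subtype.ext hk
          simp [g, hV, hj]
        · simp [g, hV, hk]) ih (h j)
    have hφ : Measurable fun (p : ({k : Fin n // k ≠ i} → α × ℝ) × ℝ)
        (k : {k : Fin n // k ≠ i}) => if k = j then ((p.1 k).1, p.2) else p.1 k := by
      refine measurable_pi_lambda _ fun k => ?_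
      split_ifs <;> fun_prop
    have := hstep.comp measurable_id hφ
    refine (congrArg₂ (fun f g => IndepFun f g μ) rfl ?_).mp this
    funext ω k
    by_cases hk : k = j
    · subst hk
      simp [hV]
    · simp [hV, hk]

end Labels

/-! ### The two probability estimates -/

/-- The minimum norm interpolant of all labelled examples but the `i`-th. -/
noncomputable def looInterp {n d : ℕ} (x : Fin n → EuclideanSpace ℝ (Fin d)) (y : Fin n → ℝ)
    (i : Fin n) : EuclideanSpace ℝ (Fin d) :=
  interp (fun k : {k : Fin n // k ≠ i} => x k) (fun k => y k)

theorem mul_sum_sq_le_norm_sq_subtype {n d : ℕ} {x : Fin n → EuclideanSpace ℝ (Fin d)} {κ : ℝ}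
    (h : ∀ a : Fin n → ℝ, κ * ∑ k, a k ^ 2 ≤ ‖∑ k, a k • x k‖ ^ 2) (i : Fin n)
    (a : {k : Fin n // k ≠ i} → ℝ) : κ * ∑ k, a k ^ 2 ≤ ‖∑ k, a k • x k‖ ^ 2 := by
  obtain ⟨b, hb, hb0⟩ : ∃ b : Fin n → ℝ, (∀ k : {k : Fin n // k ≠ i}, b k = a k) ∧
      ∀ k : {k : Fin n // ¬k ≠ i}, b k = 0 :=
    ⟨fun k => if hk : k ≠ i then a ⟨k, hk⟩ else 0, fun k => dif_pos k.2, fun k => dif_neg k.2⟩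
  have h1 := h b
  rw [← Fintype.sum_subtype_add_sum_subtype (fun k => k ≠ i),
    ← Fintype.sum_subtype_add_sum_subtype (fun k => k ≠ i)] at h1
  simpa only [hb, hb0, zero_smul, ne_eq, zero_pow two_ne_zero, Finset.sum_const_zero,
    add_zero] using h1

theorem norm_sq_looInterp_le {n d : ℕ} {x : Fin n → EuclideanSpace ℝ (Fin d)} {y : Fin n → ℝ}
    {κ : ℝ} (hκ : 0 < κ) (h : ∀ a : Fin n → ℝ, κ * ∑ k, a k ^ 2 ≤ ‖∑ k, a k • x k‖ ^ 2)
    (hy : ∀ k, y k = 1 ∨ y k = -1) (i : Fin n) : ‖looInterp x y i‖ ^ 2 ≤ n / κ := by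
  refine (norm_sq_interp_le hκ (mul_sum_sq_le_norm_sq_subtype h i) fun k => ?_).trans ?_
  · rcases hy k with h | h <;> rw [h] <;> norm_num
  · gcongr
    exact (Fintype.card_subtype_le fun k : Fin n => k ≠ i).trans_eq (Fintype.card_fin n)

theorem isSupportVector_of_looInterp {n d : ℕ} {x : Fin n → EuclideanSpace ℝ (Fin d)}
    {y : Fin n → ℝ} {κ : ℝ} (hκ : 0 < κ)
    (h : ∀ a : Fin n → ℝ, κ * ∑ k, a k ^ 2 ≤ ‖∑ k, a k • x k‖ ^ 2)
    (hy : ∀ k, y k = 1 ∨ y k = -1) (hlt : ∀ i, |⟪x i, looInterp x y i⟫| < 1) (i : Fin n) :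
    IsSupportVector x y i := by
  refine isSupportVector_of_forall_abs_inner_lt_one (linearIndependent_of_le_norm_sq hκ h) hy
    (fun i => ?_) (fun i k hk => ?_) hlt i
  · rw [looInterp, interp]
    exact Submodule.sum_mem _ fun k _ => Submodule.smul_mem _ _
      (Submodule.subset_span (Set.mem_range_self k))
  · exact inner_interp (linearIndependent_of_le_norm_sq hκ (mul_sum_sq_le_norm_sq_subtype h i))
      (fun k => y k) ⟨k, hk⟩

/-- A bound on the sections of an event depending on two independent variables bounds the event. -/
theorem IndepFun.measureReal_le_of_forall {Ω α β : Type*} [MeasurableSpace Ω] [MeasurableSpace α]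
    [MeasurableSpace β] {μ : Measure Ω} [IsProbabilityMeasure μ] {U : Ω → α} {V : Ω → β}
    (hU : Measurable U) (hV : Measurable V) (hUV : IndepFun U V μ) {D : Set (α × β)}
    (hD : MeasurableSet D) {ε : ℝ} (hε : 0 ≤ ε) (h : ∀ b, μ.real {ω | (U ω, b) ∈ D} ≤ ε) :
    μ.real {ω | (U ω, V ω) ∈ D} ≤ ε := by
  have hprobU : IsProbabilityMeasure (μ.map U) := Measure.isProbabilityMeasure_map hU.aemeasurable
  have hprobV : IsProbabilityMeasure (μ.map V) := Measure.isProbabilityMeasure_map hV.aemeasurable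
  have h1 : μ {ω | (U ω, V ω) ∈ D} = μ.map (fun ω => (U ω, V ω)) D :=
    (Measure.map_apply (hU.prodMk hV) hD).symm
  rw [(indepFun_iff_map_prod_eq_prod_map_map hU.aemeasurable hV.aemeasurable).1 hUV,
    Measure.prod_apply_symm hD] at h1
  have h2 : μ {ω | (U ω, V ω) ∈ D} ≤ ENNReal.ofReal ε := by
    rw [h1]
    calc ∫⁻ b, μ.map U ((fun a => (a, b)) ⁻¹' D) ∂(μ.map V)
        ≤ ∫⁻ _, ENNReal.ofReal ε ∂(μ.map V) := lintegral_mono fun b => by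
          rw [Measure.map_apply hU (hD.preimage (by fun_prop))]
          exact (ENNReal.le_ofReal_iff_toReal_le (measure_ne_top _ _) hε).2 (h b)
      _ = ENNReal.ofReal ε := by simp
  exact ENNReal.toReal_le_of_le_ofReal hε h2

theorem measurable_featureVec {Ω : Type*} [MeasurableSpace Ω] {μ : Measure Ω} {n d : ℕ} {v : ℝ≥0}
    {lam : Fin d → ℝ} {z : Fin n → Fin d → Ω → ℝ} (hz : IndependentFeatures z v μ) (i : Fin n) :
    Measurable (featureVec lam z i) := by
  have := hz.measurable
  unfold featureVec
  fun_prop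

theorem indepFun_featureVec {Ω : Type*} [MeasurableSpace Ω] {μ : Measure Ω} {n d : ℕ} {v : ℝ≥0}
    {lam : Fin d → ℝ} {z : Fin n → Fin d → Ω → ℝ} (hz : IndependentFeatures z v μ) (i : Fin n) :
    IndepFun (featureVec lam z i)
      (fun ω (k : {k : Fin n // k ≠ i}) => featureVec lam z k ω) μ := by
  have h1 : iIndepFun (featureVec lam z) μ :=
    (iIndepFun_curry hz.measurable hz.indep).comp
      (fun _ a => WithLp.toLp 2 fun j => √(lam j) * a j) fun _ => by fun_prop
  have h2 := h1.indepFun_finset {i} (Finset.univ.erase i) (by simp)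
    (measurable_featureVec hz)
  exact h2.comp (φ := fun a : ({i} : Finset (Fin n)) → EuclideanSpace ℝ (Fin d) => a ⟨i, by simp⟩)
    (ψ := fun (a : Finset.univ.erase i → EuclideanSpace ℝ (Fin d))
      (k : {k : Fin n // k ≠ i}) => a ⟨k, by simp [k.2]⟩) (by fun_prop) (by fun_prop)

section Features

variable {Ω : Type*} [MeasurableSpace Ω] {μ : Measure Ω} [IsProbabilityMeasure μ] {n d : ℕ}
  {v : ℝ≥0} {lam : Fin d → ℝ} {z : Fin n → Fin d → Ω → ℝ}

/-- Deviation of `‖∑ cₖ xₖ‖²` from its mean for a fixed coefficient vector of norm `2`. -/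
theorem measureReal_norm_sq_sum_smul_le (hz : IndependentFeatures z v μ) (hv : 0 < v)
    (hlam0 : lam ≠ 0) (hlam : ∀ j, 0 ≤ lam j) {c : EuclideanSpace ℝ (Fin n)} (hc : ‖c‖ = 2) :
    μ.real {ω | (∑ j, lam j) / 16 ≤
        |‖∑ k, c k • featureVec lam z k ω‖ ^ 2 - 4 * ∑ j, lam j|} ≤
      2 * Real.exp (-(1 / 6291456) *
        min (effDimTwo lam / (v : ℝ) ^ 2) (effDimInf lam / (v : ℝ))) := by
  set u : Fin n → ℝ := fun k => c k / 2 with hu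
  have hu1 : ∑ k, u k ^ 2 = 1 := by
    have h1 := EuclideanSpace.real_norm_sq_eq c
    rw [hc] at h1
    simp only [hu, div_pow, ← Finset.sum_div, ← h1]
    norm_num
  set Y : Fin d → Ω → ℝ := fun j ω => ∑ k, u k * z k j ω with hY
  have hzm := hz.measurable
  have hrow : ∀ j, iIndepFun (fun k => z k j) μ := fun j =>
    hz.indep.precomp (g := fun k => (k, j)) fun k k' hk => (Prod.mk.inj hk).1
  have hYind : iIndepFun Y μ :=
    (iIndepFun_curry (X := fun j k => z k j) (fun j k => hzm k j)
      (hz.indep.precomp (g := Prod.swap) Prod.swap_injective)).comp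
      (fun _ a => ∑ k, u k * a k) fun _ => by fun_prop
  have h := measureReal_weighted_sum_sq_le (Y := Y) (lam := lam) (by fun_prop) hYind hv
    (fun j => hasSubgaussianMGF_sum_mul (hrow j) (fun k => hz.subGaussian k j) u
      (by rw [hu1, mul_one]))
    (fun j => by
      rw [← hu1]
      exact integral_sum_mul_sq (hrow j) (fun k => (hz.subGaussian k j).memLp 2)
        (fun k => hz.mean_zero k j) (fun k => hz.unit_variance k j) u) hlam0 hlam
  refine (measureReal_mono fun ω hω => ?_).trans h
  have hnorm : ‖∑ k, c k • featureVec lam z k ω‖ ^ 2 = 4 * ∑ j, lam j * Y j ω ^ 2 := by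
    rw [EuclideanSpace.real_norm_sq_eq, Finset.mul_sum]
    refine Finset.sum_congr rfl fun j _ => ?_
    have h1 : (∑ k, c k • featureVec lam z k ω) j = √(lam j) * (2 * Y j ω) := by
      simp only [featureVec, hY, hu, WithLp.ofLp_sum, WithLp.ofLp_smul, Finset.sum_apply,
        Pi.smul_apply, smul_eq_mul, Finset.mul_sum]
      refine Finset.sum_congr rfl fun k _ => ?_
      ring
    rw [h1, mul_pow, Real.sq_sqrt (hlam j)]
    ring
  simp only [Set.mem_ofPred_eq] at hω ⊢
  rw [hnorm, ← mul_sub, abs_mul, abs_of_pos (by norm_num : (0 : ℝ) < 4)] at hω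
  linarith

theorem measureReal_one_le_abs_inner_featureVec_le (hz : IndependentFeatures z v μ)
    (hlam : ∀ j, 0 ≤ lam j) (i : Fin n) {w : EuclideanSpace ℝ (Fin d)} {R : ℝ}
    (hw : ‖w‖ ^ 2 ≤ R) :
    μ.real {ω | 1 ≤ |⟪featureVec lam z i ω, w⟫|} ≤
      2 * Real.exp (-1 / (2 * (v * (‖lam‖ * R)))) := by
  have hR : 0 ≤ R := (sq_nonneg _).trans hw
  have hrow : iIndepFun (z i) μ :=
    hz.indep.precomp (g := fun j => (i, j)) fun j j' hj => (Prod.mk.inj hj).2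
  set X : Ω → ℝ := fun ω => ∑ j, √(lam j) * w j * z i j ω with hX
  have hinner : ∀ ω, ⟪featureVec lam z i ω, w⟫ = X ω := fun ω => by
    simp only [PiLp.inner_apply, featureVec, hX, RCLike.inner_apply, conj_trivial]
    exact Finset.sum_congr rfl fun j _ => by ring
  have hsub : HasSubgaussianMGF X (v * (‖lam‖₊ * R.toNNReal)) μ := by
    refine hasSubgaussianMGF_sum_mul hrow (hz.subGaussian i) (fun j => √(lam j) * w j) ?_
    push_cast
    rw [Real.coe_toNNReal R hR]
    refine mul_le_mul_of_nonneg_left ?_ v.2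
    calc ∑ j, (√(lam j) * w j) ^ 2 = ∑ j, lam j * w j ^ 2 :=
          Finset.sum_congr rfl fun j _ => by rw [mul_pow, Real.sq_sqrt (hlam j)]
      _ ≤ ∑ j, ‖lam‖ * w j ^ 2 := by
          gcongr with j
          exact (le_abs_self _).trans (norm_le_pi_norm lam j)
      _ = ‖lam‖ * ‖w‖ ^ 2 := by rw [← Finset.mul_sum, EuclideanSpace.real_norm_sq_eq]
      _ ≤ ‖lam‖ * R := by gcongr
  have hup := hsub.measure_ge_le zero_le_one
  have hlow := hsub.neg.measure_ge_le zero_le_one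
  simp only [NNReal.coe_mul, coe_nnnorm, Real.coe_toNNReal R hR, one_pow, Pi.neg_apply]
    at hup hlow
  have hcov : {ω | 1 ≤ |⟪featureVec lam z i ω, w⟫|} ⊆ {ω | 1 ≤ X ω} ∪ {ω | 1 ≤ -X ω} := by
    intro ω hω
    simp only [Set.mem_ofPred_eq, hinner] at hω
    exact le_abs.1 hω
  calc _ ≤ _ := measureReal_mono hcov
    _ ≤ _ := measureReal_union_le _ _
    _ ≤ _ := by linarith

theorem measureReal_looInterp_le (hz : IndependentFeatures z v μ) (hlam : ∀ j, 0 ≤ lam j)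
    {y : Fin n → Ω → ℝ} (hy : LabelModel (featureVec lam z) y μ) (i : Fin n) {R : ℝ} :
    μ.real {ω | ‖looInterp (fun k => featureVec lam z k ω) (fun k => y k ω) i‖ ^ 2 ≤ R ∧
        1 ≤ |⟪featureVec lam z i ω,
          looInterp (fun k => featureVec lam z k ω) (fun k => y k ω) i⟫|} ≤
      2 * Real.exp (-1 / (2 * (v * (‖lam‖ * R)))) := by
  have hx := measurable_featureVec (lam := lam) hz
  have hym := hy.measurable
  have hind := indepFun_labelled_of_condIndepGiven hx hym hy.condIndep i
    (indepFun_featureVec hz i)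
  set W : ({k : Fin n // k ≠ i} → EuclideanSpace ℝ (Fin d) × ℝ) → EuclideanSpace ℝ (Fin d) :=
    fun p => interp (fun k => (p k).1) (fun k => (p k).2) with hW
  have hWm : Measurable W := measurable_interp
  have hrest : Measurable fun ω (k : {k : Fin n // k ≠ i}) => (featureVec lam z k ω, y k ω) :=
    measurable_pi_lambda _ fun k => (hx k).prodMk (hym k)
  have hD1 : MeasurableSet {p : EuclideanSpace ℝ (Fin d) × EuclideanSpace ℝ (Fin d) |
      ‖p.2‖ ^ 2 ≤ R} := measurableSet_le (by fun_prop) measurable_const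
  have hD2 : MeasurableSet {p : EuclideanSpace ℝ (Fin d) × EuclideanSpace ℝ (Fin d) |
      1 ≤ |⟪p.1, p.2⟫|} :=
    measurableSet_le measurable_const (Continuous.measurable (by fun_prop))
  have key := IndepFun.measureReal_le_of_forall (hx i) (hWm.comp hrest)
    (hind.comp measurable_id hWm) (hD1.inter hD2)
    (ε := 2 * Real.exp (-1 / (2 * (v * (‖lam‖ * R))))) (by positivity) fun w => by
      by_cases hw : ‖w‖ ^ 2 ≤ R
      · simpa only [Set.mem_inter_iff, Set.mem_ofPred_eq, hw, true_and] using
          measureReal_one_le_abs_inner_featureVec_le hz hlam i hw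
      · simp only [Set.mem_inter_iff, Set.mem_ofPred_eq, hw, false_and]
        simpa using (Real.exp_pos _).le
  exact key

end Features

/-! ### Assembling the bounds -/

theorem theorem1 :
    ∃ C c : ℝ, 0 < C ∧ 0 < c ∧
      ∀ {Ω : Type*} [MeasurableSpace Ω] (μ : Measure Ω) [IsProbabilityMeasure μ]
        (n d : ℕ) (_ : 1 ≤ n) (_ : 1 ≤ d)
        (v : ℝ≥0) (_ : 0 < v)
        (lam : Fin d → ℝ) (_ : ∀ j, 0 < lam j)
        (z : Fin n → Fin d → Ω → ℝ) (_ : IndependentFeatures z v μ)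
        (y : Fin n → Ω → ℝ) (_ : LabelModel (featureVec lam z) y μ),
        1 - Real.exp (-c * min (effDimTwo lam / (v : ℝ) ^ 2) (effDimInf lam / (v : ℝ)) + C * n)
            - Real.exp (-c * (effDimInf lam / ((v : ℝ) * n)) + C * Real.log n)
          ≤ μ.real {ω | ∀ i, IsSupportVector (fun k => featureVec lam z k ω)
              (fun k => y k ω) i} := by
  refine ⟨3, 1 / 6291456, by norm_num, by norm_num, ?_⟩
  intro Ω _ μ _ n d hn hd v hv lam hlam z hz y hy
  have hv' : (0 : ℝ) < v := hv
  have hn' : (0 : ℝ) < n := by exact_mod_cast hn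
  have hlam' : ∀ j, 0 ≤ lam j := fun j => (hlam j).le
  have hlam0 : lam ≠ 0 := fun h0 => (hlam ⟨0, hd⟩).ne' (congrFun h0 _)
  have hΛ : 0 < ‖lam‖ := norm_pos_iff.2 hlam0
  set L := ∑ j, lam j
  have hL0 : 0 < L := Finset.sum_pos (fun j _ => hlam j) ⟨⟨0, hd⟩, Finset.mem_univ _⟩
  have habs : ∑ j, |lam j| = L := Finset.sum_congr rfl fun j _ => abs_of_nonneg (hlam' j)
  set m := min (effDimTwo lam / (v : ℝ) ^ 2) (effDimInf lam / (v : ℝ))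
  set x : Ω → Fin n → EuclideanSpace ℝ (Fin d) := fun ω k => featureVec lam z k ω
  set w : Ω → Fin n → EuclideanSpace ℝ (Fin d) :=
    fun ω i => looInterp (x ω) (fun k => y k ω) i with hw
  obtain ⟨N, hNcard, hN, hnet⟩ := exists_finset_net_sphere (EuclideanSpace ℝ (Fin n))
  rw [finrank_euclideanSpace_fin] at hNcard
  let A : Set Ω := ⋃ c ∈ N, {ω | L / 16 ≤ |‖∑ k, c k • x ω k‖ ^ 2 - 4 * L|}
  let B : Set Ω := ⋃ i, {ω | ‖w ω i‖ ^ 2 ≤ n / (L / 2) ∧ 1 ≤ |⟪x ω i, w ω i⟫|}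
  have hcover : {ω | ∀ i, IsSupportVector (x ω) (fun k => y k ω) i}ᶜ ⊆ A ∪ B := by
    intro ω hω
    by_contra hAB
    simp only [A, B, Set.mem_union, Set.mem_iUnion, Set.mem_ofPred_eq, not_or, not_exists,
      not_le, not_and] at hAB
    obtain ⟨hA, hB⟩ := hAB
    refine hω ?_
    have hquad : ∀ a : Fin n → ℝ, L / 2 * ∑ k, a k ^ 2 ≤ ‖∑ k, a k • x ω k‖ ^ 2 := fun a => by
      have h1 := half_mul_norm_sq_le_of_net
        ((Fintype.linearCombination ℝ (x ω)).comp
          (WithLp.linearEquiv 2 ℝ (Fin n → ℝ)).toLinearMap) (L := L) hN hnet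
        (fun c hc => by
          simpa [Fintype.linearCombination_apply] using (hA c hc).le) (WithLp.toLp 2 a)
      rw [EuclideanSpace.real_norm_sq_eq] at h1
      simpa [Fintype.linearCombination_apply] using h1
    have hsign : ∀ k, y k ω = 1 ∨ y k ω = -1 := fun k => hy.sign k ω
    exact isSupportVector_of_looInterp (half_pos hL0) hquad hsign fun i =>
      hB i (norm_sq_looInterp_le (half_pos hL0) hquad hsign i)
  have hA : μ.real A ≤ Real.exp (-(1 / 6291456) * m + 3 * n) := by
    have hfive : (2 : ℝ) * 5 ^ n ≤ Real.exp (3 * n) := by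
      have h1 : (2 : ℝ) ≤ 2 ^ n := by
        simpa using pow_le_pow_right₀ (one_le_two : (1 : ℝ) ≤ 2) hn
      have h2 : (10 : ℝ) ≤ Real.exp 3 := by
        have h3 : Real.exp 3 = Real.exp 1 ^ 3 := by rw [← Real.exp_nat_mul]; norm_num
        have h4 : (2.7 : ℝ) ^ 3 ≤ Real.exp 1 ^ 3 := by
          gcongr
          linarith [Real.exp_one_gt_d9]
        rw [h3]
        refine le_trans (by norm_num) h4
      calc (2 : ℝ) * 5 ^ n ≤ 2 ^ n * 5 ^ n := by gcongr
        _ = 10 ^ n := by rw [← mul_pow]; norm_num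
        _ ≤ Real.exp 3 ^ n := by gcongr
        _ = Real.exp (3 * n) := by rw [← Real.exp_nat_mul, mul_comm]
    calc μ.real A ≤ ∑ c ∈ N, μ.real {ω | L / 16 ≤ |‖∑ k, c k • x ω k‖ ^ 2 - 4 * L|} :=
          measureReal_biUnion_finset_le _ _
      _ ≤ ∑ c ∈ N, 2 * Real.exp (-(1 / 6291456) * m) := Finset.sum_le_sum fun c hc =>
          measureReal_norm_sq_sum_smul_le hz hv hlam0 hlam' (hN c hc)
      _ = N.card * (2 * Real.exp (-(1 / 6291456) * m)) := by rw [Finset.sum_const, nsmul_eq_mul]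
      _ ≤ 5 ^ n * (2 * Real.exp (-(1 / 6291456) * m)) := by
          gcongr
          exact_mod_cast hNcard
      _ = Real.exp (-(1 / 6291456) * m) * (2 * 5 ^ n) := by ring
      _ ≤ Real.exp (-(1 / 6291456) * m) * Real.exp (3 * n) := by gcongr
      _ = _ := (Real.exp_add _ _).symm
  have hB : μ.real B ≤
      Real.exp (-(1 / 6291456) * (effDimInf lam / ((v : ℝ) * n)) + 3 * Real.log n) := by
    rcases hn.eq_or_lt with rfl | hn2
    · -- a single example is interpolated against the empty family, by `w = 0`
      have hBempty : B = ∅ := by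
        refine Set.eq_empty_of_forall_notMem fun ω hω => ?_
        simp only [B, Set.mem_iUnion, Set.mem_ofPred_eq] at hω
        obtain ⟨i, -, hi⟩ := hω
        have hempty : IsEmpty {k : Fin 1 // k ≠ i} := ⟨fun k => k.2 (Subsingleton.elim _ _)⟩
        have hw0 : w ω i = 0 := by simp [hw, looInterp, interp]
        rw [hw0, inner_zero_right, abs_zero] at hi
        linarith
      rw [hBempty, measureReal_empty]
      exact (Real.exp_pos _).le
    · have hn2' : (2 : ℝ) ≤ n := by exact_mod_cast hn2
      have hinf : 0 ≤ effDimInf lam / ((v : ℝ) * n) := by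
        rw [effDimInf]
        positivity
      have hexp : -1 / (2 * (v * (‖lam‖ * (n / (L / 2))))) ≤
          -(1 / 6291456) * (effDimInf lam / ((v : ℝ) * n)) := by
        have h1 : -1 / (2 * (v * (‖lam‖ * (n / (L / 2))))) =
            -(1 / 4) * (effDimInf lam / ((v : ℝ) * n)) := by
          rw [effDimInf, habs]
          field_simp
          norm_num
        rw [h1]
        nlinarith
      calc μ.real B ≤ ∑ i, μ.real {ω | ‖w ω i‖ ^ 2 ≤ n / (L / 2) ∧ 1 ≤ |⟪x ω i, w ω i⟫|} :=
            measureReal_iUnion_fintype_le _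
        _ ≤ ∑ _i : Fin n, 2 * Real.exp (-1 / (2 * (v * (‖lam‖ * (n / (L / 2)))))) :=
            Finset.sum_le_sum fun i _ => measureReal_looInterp_le hz hlam' hy i
        _ = 2 * n * Real.exp (-1 / (2 * (v * (‖lam‖ * (n / (L / 2)))))) := by
            rw [Finset.sum_const, Finset.card_univ, Fintype.card_fin, nsmul_eq_mul]
            ring
        _ ≤ n ^ 3 * Real.exp (-(1 / 6291456) * (effDimInf lam / ((v : ℝ) * n))) := by
            gcongr
            nlinarith [mul_le_mul hn2' hn2' zero_le_two hn'.le]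
        _ = _ := by
            have h3 : Real.exp (3 * Real.log n) = n ^ 3 := by
              rw [← Real.exp_log hn', ← Real.exp_nat_mul, Real.exp_log hn']
              norm_num
            rw [Real.exp_add, h3, mul_comm]
  have htotal := (measureReal_mono (μ := μ) hcover).trans (measureReal_union_le A B)
  have hone := measureReal_union_le (μ := μ)
    {ω | ∀ i, IsSupportVector (x ω) (fun k => y k ω) i}
    {ω | ∀ i, IsSupportVector (x ω) (fun k => y k ω) i}ᶜ
  rw [Set.union_compl_self, probReal_univ] at hone
  linarith
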